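/- **Conventions.** A *simple curve* is a set $C\subseteq\mathbb R^2$ that has an injective continuous parametrization $f:[0,1]\to\mathbb R^2$, i.e. $f([0,1])=C$. Its *length* $l(C)\in[0,\infty]$ is the supremum of $\sum_{i<n}|f(a_i)-f(a_{i+1})|$ over all partitions $0=a_0<\dots<a_n=1$, for any such $f$ (a single point has length $0$); $C$ is *rectifiable* if $l(C)<\infty$. A *nontrivial segment* of $C$ is a set $f([a,b])$ with $0\le a<b\le 1$, where $f$ is an injective continuous parametrization of $C$. A real number $x$ is *computable* if there is a computable sequence $(x_n)$ of rational numbers with $|x_n-x_{n+1}|\le 2^{-n}$ for all $n$ and $x_n\to x$. A function $f:[0,1]\to\mathbb R^2$ is *computable* if there is a computable sequence $(p_n)$ of rational polygon functions (continuous, piecewise affine, with finitely many rational breakpoints and rational vertices) such that $|f(t)-p_n(t)|\le 2^{-n}$ for all $n$ and all $t\in[0,1]$. For $\varepsilon>0$ let $V_\varepsilon(a,b)$ be the open square $\{(x,y):|x-a|<\varepsilon,\ |y-b|<\varepsilon\}$ (a *rational neighborhood* if $a,b,\varepsilon\in\mathbb Q$), let $V_\varepsilon(A)=\bigcup_{z\in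 A}V_\varepsilon(z)$, and let $d_H(A,B)=\inf\{\varepsilon>0: A\subseteq V_\varepsilon(B),\ B\subseteq V_\varepsilon(A)\}$. A simple curve $C$ is called - *$K$-computable* if there is a computable sequence $(Q_n)$ of finite sets of rational neighborhoods with $C\subseteq\bigcup Q_n$ and $d_H(\bigcup Q_n,C)<2^{-n}$ for all $n$; - *$R$-computable* if $C=f([0,1])$ for some computable $f:[0,1]\to\mathbb R^2$; - *$M$-computable* if $C=f([0,1])$ for some injective computable $f:[0,1]\to\mathbb R^2$; - *$N$-computable* if $C$ is rectifiable and $C=f([0,1])$ for some computable $f:[0,1]\to\mathbb R^2$ such that the curve segment $f([0,t])$ has length $t\cdot l(C)$ for all $t\in[0,1]$. Let $\mathbf C_C$ be the class of all simple curves that are $K$-, $R$-, $M$- or $N$-computable and whose length is finite and a computable real number. **Lemma.** Let $C$ be an $N$-computable curve. 1. If the length of $C$ is not a computable real number, then no nontrivial segment of $C$ belongs to $\mathbf C_C$; that is, no nontrivial segment of $C$ that is $K$-, $R$-, $M$- or $N$-computable has computable length. 2. Consequently, either $C\in\mathbf C_C$, or no nontrivial segment of $C$ belongs to $\mathbf C_C$.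 -/

import Mathlib

open Set Filter Topology
open scoped ENNReal

/-- The Euclidean plane. -/
abbrev Plane : Type := EuclideanSpace ℝ (Fin 2)

/-! ### Rational numbers as finite data, computable reals -/

/-- Names of rational numbers: `(a, b, c)` stands for `(a - b) / (c + 1)`. -/
abbrev RatCode : Type := ℕ × ℕ × ℕ

/-- The rational number named by a code, as a real number. -/
noncomputable def RatCode.val (q : RatCode) : ℝ :=
  ((q.1 : ℝ) - (q.2.1 : ℝ)) / ((q.2.2 : ℝ) + 1)

/-- A real number is computable if some computable sequence of rational numbers converges to it
with `|x n - x (n + 1)| ≤ 2 ^ (-n)`. -/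
def IsComputableReal (x : ℝ) : Prop :=
  ∃ c : ℕ → RatCode, Computable c ∧
    (∀ n, |(c n).val - (c (n + 1)).val| ≤ (1 / 2 : ℝ) ^ n) ∧
    Tendsto (fun n => (c n).val) atTop (𝓝 x)

/-! ### Computable functions on the unit interval -/

/-- Three rational numbers `(t, x, y)`. For polygon functions, `t` is the knot and `(x, y)` the
vertex; for square neighbourhoods, the first two are the centre and the third the radius. -/
abbrev RatTriple : Type := RatCode × RatCode × RatCode

/-- The knot `t` of `(t, x, y)`. -/
noncomputable def RatTriple.knot (v : RatTriple) : ℝ := v.1.val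

/-- The vertex `(x, y)` of `(t, x, y)`. -/
noncomputable def RatTriple.vertex (v : RatTriple) : Plane := !₂[v.2.1.val, v.2.2.val]

/-- `p` is, on `[0, 1]`, the rational polygon function with the listed knots
`0 = t₀ < t₁ < ⋯ < tᵣ = 1` and vertices `q₀, …, qᵣ`: it maps `[tᵢ, tᵢ₊₁]` affinely onto the
line segment from `qᵢ` to `qᵢ₊₁`. -/
def IsRationalPolygonFun (L : List RatTriple) (p : ℝ → Plane) : Prop :=
  (L.map RatTriple.knot).Pairwise (· < ·) ∧
  (L.map RatTriple.knot).head? = some 0 ∧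
  (L.map RatTriple.knot).getLast? = some 1 ∧
  ∀ (i : ℕ) (hi : i + 1 < L.length), ∀ s ∈ Icc (0 : ℝ) 1,
    p (AffineMap.lineMap L[i].knot L[i + 1].knot s) =
      AffineMap.lineMap L[i].vertex L[i + 1].vertex s

/-- `f`, restricted to `[0, 1]`, is a computable function into the plane: a computable sequence
of rational polygon functions converges to it uniformly and effectively. -/
def IsComputableFun (f : ℝ → Plane) : Prop :=
  ∃ L : ℕ → List RatTriple, Computable L ∧
    ∃ p : ℕ → ℝ → Plane, ∀ n, IsRationalPolygonFun (L n) (p n) ∧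
      ∀ t ∈ Icc (0 : ℝ) 1, dist (f t) (p n t) ≤ (1 / 2 : ℝ) ^ n

/-! ### Simple curves, their segments and lengths -/

/-- `f` is an injective continuous parametrization of `S` on the interval `[a, b]`; the case
`a = b`, in which `S` is a point, is allowed. -/
def IsInjParam (f : ℝ → Plane) (a b : ℝ) (S : Set Plane) : Prop :=
  a ≤ b ∧ ContinuousOn f (Icc a b) ∧ InjOn f (Icc a b) ∧ f '' Icc a b = S

/-- Simple (open) planar curves. -/
def IsSimpleCurve (C : Set Plane) : Prop :=
  ∃ f : ℝ → Plane, IsInjParam f 0 1 C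

/-- The length of a simple curve (or of a point): the supremum of the lengths of inscribed
polygons, for an injective parametrization. All injective parametrizations of `S` give the same
value, so that the infimum over them is just this common value. -/
noncomputable def arcLength (S : Set Plane) : ℝ≥0∞ :=
  ⨅ (f : ℝ → Plane) (a : ℝ) (b : ℝ) (_ : IsInjParam f a b S), eVariationOn f (Icc a b)

/-- Curves of finite length. -/
def IsRectifiable (C : Set Plane) : Prop := arcLength C ≠ ⊤

/-- The length is finite and a computable real number. -/
def HasComputableLength (C : Set Plane) : Prop :=
  arcLength C ≠ ⊤ ∧ IsComputableReal (arcLength C).toReal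

/-- `S` is a nontrivial segment of the simple curve `C`: the part of `C` between two different
parameters of an injective parametrization. -/
def IsNontrivialSegment (S C : Set Plane) : Prop :=
  ∃ g : ℝ → Plane, IsInjParam g 0 1 C ∧
    ∃ a b : ℝ, 0 ≤ a ∧ a < b ∧ b ≤ 1 ∧ S = g '' Icc a b

/-! ### Neighbourhoods and Hausdorff distance -/

/-- The `ε`-neighbourhood of a point: an open axis-parallel square. -/
def squareNhd (ε : ℝ) (z : Plane) : Set Plane :=
  {w | |w 0 - z 0| < ε ∧ |w 1 - z 1| < ε}

/-- The `ε`-neighbourhood of a set. -/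
def setNhd (ε : ℝ) (A : Set Plane) : Set Plane := ⋃ z ∈ A, squareNhd ε z

/-- The Hausdorff distance (of nonempty bounded sets). -/
noncomputable def planeHausdorffDist (A B : Set Plane) : ℝ :=
  sInf {ε : ℝ | 0 < ε ∧ A ⊆ setNhd ε B ∧ B ⊆ setNhd ε A}

/-- The centre of the square neighbourhood given by `(x, y, ε)`. -/
noncomputable def RatTriple.center (v : RatTriple) : Plane := !₂[v.1.val, v.2.1.val]

/-- The radius of the square neighbourhood given by `(x, y, ε)`. -/
noncomputable def RatTriple.radius (v : RatTriple) : ℝ := v.2.2.val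

/-- The union of the finitely many rational neighbourhoods in a list. -/
def coverUnion (Q : List RatTriple) : Set Plane :=
  ⋃ v ∈ Q, squareNhd v.radius v.center

/-! ### The four versions of computable curves -/

/-- `K`-computable curves: effectively approximated by finite rational covers. -/
def IsKComputable (C : Set Plane) : Prop :=
  IsSimpleCurve C ∧
  ∃ Q : ℕ → List RatTriple, Computable Q ∧
    ∀ n, (∀ v ∈ Q n, 0 < v.radius) ∧ C ⊆ coverUnion (Q n) ∧
      planeHausdorffDist (coverUnion (Q n)) C < (1 / 2 : ℝ) ^ n

/-- `R`-computable curves: with a computable parametrization, which may retrace. -/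
def IsRComputable (C : Set Plane) : Prop :=
  IsSimpleCurve C ∧ ∃ f : ℝ → Plane, IsComputableFun f ∧ f '' Icc 0 1 = C

/-- `M`-computable curves: with an injective computable parametrization. -/
def IsMComputable (C : Set Plane) : Prop :=
  IsSimpleCurve C ∧
  ∃ f : ℝ → Plane, IsComputableFun f ∧ InjOn f (Icc 0 1) ∧ f '' Icc 0 1 = C

/-- `N`-computable curves: rectifiable, with a computable length-normalized parametrization. -/
def IsNComputable (C : Set Plane) : Prop :=
  IsSimpleCurve C ∧ IsRectifiable C ∧
  ∃ f : ℝ → Plane, IsComputableFun f ∧ f '' Icc 0 1 = C ∧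
    ∀ t ∈ Icc (0 : ℝ) 1, arcLength (f '' Icc 0 t) = ENNReal.ofReal t * arcLength C

/-- The class of the computable curves of computable length, where "computable" may be taken in
any of the four versions. -/
def curvesOfComputableLength : Set (Set Plane) :=
  {C | (IsKComputable C ∨ IsRComputable C ∨ IsMComputable C ∨ IsNComputable C) ∧
    HasComputableLength C}

/-! Let `f` be the computable length-normalized parametrization of `C` and `l` its length. A
nontrivial segment is `S = f '' Icc s t` with `s < t`, and its length is `l * (t - s)`. If that
length is computable and `S` is computable in any of the four senses, both rational cuts of `l` are
semidecidable, so `l` is computable. Part 2 is then a case distinction.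

Lower cut (`semidecidable_lt_speed`): `l` is the least Lipschitz constant of `f`, so `q < l` is
confirmed by a single chord that is too long. This uses only the computability of `f`.

Upper cut (`isComputableReal_of_segment`): all four notions let one enumerate rational points near
`S`. As `f '' Icc u v` is compact with an effective modulus, `S ⊄ f '' Icc u v` is semidecidable for
rational `u`, `v` (`exists_semidecidable_not_subset`). With `v = 1` this says `s < u`, with `u = 0`
it says `v < t`. Hence `t - s` is approximable from below, and `l`, the quotient of a computable
number by `t - s`, from above. The numbers `s` and `t` need not be shown computable. -/

/-! ### Decidable and semidecidable predicates -/

section Semidecidable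

variable {α β : Type*} [Primcodable α] [Primcodable β]

theorem ComputablePred.comp {p : β → Prop} (hp : ComputablePred p) {f : α → β}
    (hf : Computable f) : ComputablePred fun a => p (f a) := by
  obtain ⟨_, hp⟩ := hp
  exact ⟨fun a => inferInstance, hp.comp hf⟩

theorem ComputablePred.and {p q : α → Prop} (hp : ComputablePred p) (hq : ComputablePred q) :
    ComputablePred fun a => p a ∧ q a := by
  obtain ⟨_, hp⟩ := hp
  obtain ⟨_, hq⟩ := hq
  refine ⟨fun a => inferInstance, ?_⟩
  refine (Primrec.and.to_comp.comp hp hq).of_eq fun a => ?_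
  simp

theorem ComputablePred.or {p q : α → Prop} (hp : ComputablePred p) (hq : ComputablePred q) :
    ComputablePred fun a => p a ∨ q a :=
  (hp.not.and hq.not).not.of_eq fun a => by tauto

theorem ComputablePred.forall_lt {p : α → ℕ → Prop} (hp : ComputablePred fun x : α × ℕ => p x.1 x.2)
    {N : α → ℕ} (hN : Computable N) : ComputablePred fun a => ∀ k < N a, p a k := by
  classical
  obtain ⟨_, hp⟩ := hp
  refine Computable.computablePred ?_
  have h : Computable fun a => (Nat.rec true (fun k b => b && decide (p a k)) (N a) : Bool) := by
    refine Computable.nat_rec (f := N) (g := fun _ => true)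
      (h := fun a (x : ℕ × Bool) => x.2 && decide (p a x.1)) hN (Computable.const true) ?_
    refine Primrec.and.to_comp.comp (Computable.snd.comp Computable.snd) ?_
    exact (hp.comp (Computable.pair Computable.fst (Computable.fst.comp Computable.snd))).of_eq
      fun a => by congr
  refine h.of_eq fun a => ?_
  induction N a with
  | zero => simp
  | succ n ih =>
    simp only [ih, Nat.lt_succ_iff_lt_or_eq, or_imp, forall_and, forall_eq]
    simp

/-- A predicate is semidecidable if it is the projection of a decidable one. -/
def Semidecidable (p : α → Prop) : Prop :=
  ∃ q : α → ℕ → Prop, (ComputablePred fun x : α × ℕ => q x.1 x.2) ∧ ∀ a, p a ↔ ∃ w, q a w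

theorem ComputablePred.semidecidable {p : α → Prop} (hp : ComputablePred p) : Semidecidable p :=
  ⟨fun a _ => p a, hp.comp Computable.fst, fun a => by simp⟩

theorem Semidecidable.of_iff {p q : α → Prop} (hp : Semidecidable p) (h : ∀ a, p a ↔ q a) :
    Semidecidable q := by
  rwa [← funext fun a => propext (h a)]

theorem Semidecidable.comp {p : β → Prop} (hp : Semidecidable p) {f : α → β} (hf : Computable f) :
    Semidecidable fun a => p (f a) := by
  obtain ⟨q, hq, h⟩ := hp
  exact ⟨fun a w => q (f a) w,
    hq.comp (f := fun x : α × ℕ => (f x.1, x.2)) ((hf.comp Computable.fst).pair Computable.snd),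
    fun a => h (f a)⟩

theorem Semidecidable.exists_nat {p : α → ℕ → Prop}
    (hp : Semidecidable fun x : α × ℕ => p x.1 x.2) : Semidecidable fun a => ∃ k, p a k := by
  obtain ⟨q, hq, h⟩ := hp
  refine ⟨fun a w => q (a, w.unpair.1) w.unpair.2, ?_, fun a => ?_⟩
  · have hw : Computable fun x : α × ℕ => x.2.unpair := Computable.unpair.comp Computable.snd
    exact hq.comp (f := fun x : α × ℕ => ((x.1, x.2.unpair.1), x.2.unpair.2))
      ((Computable.fst.pair (Computable.fst.comp hw)).pair (Computable.snd.comp hw))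
  · constructor
    · rintro ⟨k, hk⟩
      obtain ⟨w, hw⟩ := (h (a, k)).1 hk
      exact ⟨Nat.pair k w, by simpa using hw⟩
    · rintro ⟨w, hw⟩
      exact ⟨_, (h (a, w.unpair.1)).2 ⟨_, hw⟩⟩

theorem Semidecidable.and {p q : α → Prop} (hp : Semidecidable p) (hq : Semidecidable q) :
    Semidecidable fun a => p a ∧ q a := by
  obtain ⟨p', hp', h⟩ := hp
  obtain ⟨q', hq', h'⟩ := hq
  refine ⟨fun a w => p' a w.unpair.1 ∧ q' a w.unpair.2, ?_, fun a => ?_⟩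
  · have hw : Computable fun x : α × ℕ => x.2.unpair := Computable.unpair.comp Computable.snd
    exact (hp'.comp (f := fun x : α × ℕ => (x.1, x.2.unpair.1))
      (Computable.fst.pair (Computable.fst.comp hw))).and
      (hq'.comp (f := fun x : α × ℕ => (x.1, x.2.unpair.2))
        (Computable.fst.pair (Computable.snd.comp hw)))
  · beta_reduce
    rw [h, h']
    constructor
    · rintro ⟨⟨v, hv⟩, w, hw⟩
      exact ⟨Nat.pair v w, by simpa using ⟨hv, hw⟩⟩
    · rintro ⟨w, hw, hw'⟩
      exact ⟨⟨_, hw⟩, _, hw'⟩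

theorem Semidecidable.or {p q : α → Prop} (hp : Semidecidable p) (hq : Semidecidable q) :
    Semidecidable fun a => p a ∨ q a := by
  obtain ⟨p', hp', h⟩ := hp
  obtain ⟨q', hq', h'⟩ := hq
  exact ⟨fun a w => p' a w ∨ q' a w, hp'.or hq', fun a => by
    beta_reduce
    rw [h, h', exists_or]⟩

theorem ComputablePred.option {p : α → β → Prop} (hp : ComputablePred fun x : α × β => p x.1 x.2)
    {o : α → Option β} (ho : Computable o) : ComputablePred fun a => ∃ b ∈ o a, p a b := by
  classical
  obtain ⟨_, hp⟩ := hp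
  refine Computable.computablePred ?_
  have : Computable fun a => (Option.casesOn (o a) false (fun b => decide (p a b)) : Bool) :=
    Computable.option_casesOn (g := fun a b => decide (p a b)) ho (Computable.const false)
      (hp.of_eq fun y => by congr)
  refine this.of_eq fun a => ?_
  cases o a <;> simp

theorem Semidecidable.option {p : α → β → Prop} (hp : Semidecidable fun x : α × β => p x.1 x.2)
    {o : α → Option β} (ho : Computable o) : Semidecidable fun a => ∃ b ∈ o a, p a b := by
  obtain ⟨q, hq, h⟩ := hp
  refine ⟨fun a w => ∃ b ∈ o a, q (a, b) w, ?_, fun a => ?_⟩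
  · exact ComputablePred.option (p := fun (x : α × ℕ) b => q (x.1, b) x.2)
      (hq.comp (f := fun y : (α × ℕ) × β => ((y.1.1, y.2), y.1.2))
        (((Computable.fst.comp Computable.fst).pair Computable.snd).pair
          (Computable.snd.comp Computable.fst))) (ho.comp Computable.fst)
  · have h' : ∀ b, p a b ↔ ∃ w, q (a, b) w := fun b => h (a, b)
    simp only [h']
    tauto

theorem Semidecidable.exists {p : α → β → Prop} (hp : Semidecidable fun x : α × β => p x.1 x.2) :
    Semidecidable fun a => ∃ b, p a b := by
  have h : Semidecidable fun x : α × ℕ => ∃ b ∈ (Encodable.decode x.2 : Option β), p x.1 b :=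
    Semidecidable.option (p := fun (x : α × ℕ) b => p x.1 b)
      (hp.comp (f := fun y : (α × ℕ) × β => (y.1.1, y.2))
        ((Computable.fst.comp Computable.fst).pair Computable.snd))
      (Computable.decode.comp Computable.snd)
  refine (Semidecidable.exists_nat (p := fun a k => ∃ b ∈ (Encodable.decode k : Option β), p a b)
    h).of_iff fun a => ⟨?_, ?_⟩
  · rintro ⟨k, b, -, hb⟩
    exact ⟨b, hb⟩
  · rintro ⟨b, hb⟩
    exact ⟨Encodable.encode b, b, by simp, hb⟩

/-- Witnesses for a semidecidable relation can be found computably. -/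
theorem Semidecidable.exists_computable {p : α → β → Prop}
    (hp : Semidecidable fun x : α × β => p x.1 x.2) (h : ∀ a, ∃ b, p a b) :
    ∃ f : α → β, Computable f ∧ ∀ a, p a (f a) := by
  classical
  obtain ⟨q, ⟨_, hq⟩, hpq⟩ := hp
  -- A number `w` codes a candidate `b` together with a stage for its semidecision, so one unbounded
  -- search over `w` covers both.
  let o : α → ℕ → Option β := fun a w =>
    (Encodable.decode w.unpair.1 : Option β).bind fun b =>
      bif decide (q (a, b) w.unpair.2) then some b else none
  have ho : Computable₂ o := by
    have hw : Computable fun x : α × ℕ => x.2.unpair := Computable.unpair.comp Computable.snd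
    refine Computable.option_bind (f := fun x : α × ℕ => (Encodable.decode x.2.unpair.1 : Option β))
      (g := fun x b => bif decide (q (x.1, b) x.2.unpair.2) then some b else none)
      (Computable.decode.comp (Computable.fst.comp hw)) ?_
    refine Computable.cond ?_ (Computable.option_some.comp Computable.snd) (Computable.const none)
    exact (hq.comp (g := fun y : (α × ℕ) × β => ((y.1.1, y.2), y.1.2.unpair.2))
      (((Computable.fst.comp Computable.fst).pair Computable.snd).pair
        (Computable.snd.comp (hw.comp Computable.fst)))).of_eq fun y => by congr
  have hspec : ∀ a w b, b ∈ o a w → p a b := by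
    intro a w b hb
    obtain ⟨b', -, hb'⟩ := Option.bind_eq_some_iff.1 hb
    by_cases hd : q (a, b') w.unpair.2
    · simp only [hd, decide_true, cond_true, Option.some.injEq] at hb'
      subst hb'
      exact (hpq (a, b')).2 ⟨_, hd⟩
    · simp [hd] at hb'
  have hdom : ∀ a, (Nat.rfindOpt (o a)).Dom := by
    intro a
    obtain ⟨b, hb⟩ := h a
    obtain ⟨w, hw⟩ := (hpq (a, b)).1 hb
    refine Nat.rfindOpt_dom.2 ⟨Nat.pair (Encodable.encode b) w, b, ?_⟩
    simp [o, hw]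
  refine ⟨fun a => (Nat.rfindOpt (o a)).get (hdom a), ?_, fun a => ?_⟩
  · exact (Partrec.rfindOpt ho).of_eq_tot fun a => Part.get_mem _
  · obtain ⟨w, hw⟩ := Nat.rfindOpt_spec (Part.get_mem (hdom a))
    exact hspec a w _ hw

end Semidecidable

/-! ### Computable families of rational numbers -/

section RatComputable

variable {α β : Type*} [Primcodable α] [Primcodable β]

/-- A real-valued function is rationally computable if it takes rational values, and codes of
these can be computed. -/
def RatComputable (F : α → ℝ) : Prop :=
  ∃ c : α → RatCode, Computable c ∧ ∀ a, (c a).val = F a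

theorem Computable.ratComputable {c : α → RatCode} (hc : Computable c) :
    RatComputable fun a => (c a).val := ⟨c, hc, fun _ => rfl⟩

theorem RatComputable.comp {F : β → ℝ} (hF : RatComputable F) {f : α → β} (hf : Computable f) :
    RatComputable fun a => F (f a) := by
  obtain ⟨c, hc, h⟩ := hF
  exact ⟨fun a => c (f a), hc.comp hf, fun a => h (f a)⟩

theorem RatComputable.natCast {f : α → ℕ} (hf : Computable f) :
    RatComputable fun a => (f a : ℝ) :=
  ⟨fun a => (f a, 0, 0), hf.pair (Computable.const _), fun a => by simp [RatCode.val]⟩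

theorem RatComputable.const_nat (k : ℕ) : RatComputable fun _ : α => (k : ℝ) :=
  RatComputable.natCast (Computable.const k)

theorem Computable.natAdd {f g : α → ℕ} (hf : Computable f) (hg : Computable g) :
    Computable fun a => f a + g a := Primrec.nat_add.to_comp.comp hf hg

theorem Computable.natMul {f g : α → ℕ} (hf : Computable f) (hg : Computable g) :
    Computable fun a => f a * g a := Primrec.nat_mul.to_comp.comp hf hg

theorem Computable.natSub {f g : α → ℕ} (hf : Computable f) (hg : Computable g) :
    Computable fun a => f a - g a := Primrec.nat_sub.to_comp.comp hf hg

theorem Computable.two_pow {f : α → ℕ} (hf : Computable f) : Computable fun a => 2 ^ f a := by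
  have h : Primrec fun n : ℕ => 2 ^ n := by
    refine (Primrec.nat_rec₁ 1 (f := fun _ y => 2 * y)
      (Primrec.nat_mul.comp (Primrec.const 2) Primrec.snd)).of_eq fun n => ?_
    induction n with
    | zero => rfl
    | succ n ih => simp only [pow_succ, ih]; ring
  exact h.to_comp.comp hf

theorem RatComputable.neg {F : α → ℝ} (hF : RatComputable F) : RatComputable fun a => -F a := by
  obtain ⟨c, hc, h⟩ := hF
  refine ⟨fun a => ((c a).2.1, (c a).1, (c a).2.2), ?_, fun a => ?_⟩
  · have h2 := Computable.snd.comp hc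
    exact (Computable.fst.comp h2).pair ((Computable.fst.comp hc).pair (Computable.snd.comp h2))
  · beta_reduce
    rw [← h, RatCode.val, RatCode.val]
    ring

theorem RatComputable.add {F G : α → ℝ} (hF : RatComputable F) (hG : RatComputable G) :
    RatComputable fun a => F a + G a := by
  obtain ⟨c, hc, h⟩ := hF
  obtain ⟨d, hd, h'⟩ := hG
  have hc2 := Computable.snd.comp hc
  have hd2 := Computable.snd.comp hd
  have hcd := (Computable.snd.comp hc2).natAdd (Computable.const 1)
  have hdd := (Computable.snd.comp hd2).natAdd (Computable.const 1)
  refine ⟨fun a => ((c a).1 * ((d a).2.2 + 1) + (d a).1 * ((c a).2.2 + 1),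
    (c a).2.1 * ((d a).2.2 + 1) + (d a).2.1 * ((c a).2.2 + 1),
    ((c a).2.2 + 1) * ((d a).2.2 + 1) - 1), ?_, fun a => ?_⟩
  · exact (((Computable.fst.comp hc).natMul hdd).natAdd ((Computable.fst.comp hd).natMul hcd)).pair
      ((((Computable.fst.comp hc2).natMul hdd).natAdd ((Computable.fst.comp hd2).natMul hcd)).pair
        ((hcd.natMul hdd).natSub (Computable.const 1)))
  · beta_reduce
    rw [← h, ← h']
    simp only [RatCode.val]
    rw [Nat.cast_sub (Nat.mul_pos (Nat.succ_pos _) (Nat.succ_pos _))]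
    push_cast
    have h1 : ((c a).2.2 : ℝ) + 1 ≠ 0 := by positivity
    have h2 : ((d a).2.2 : ℝ) + 1 ≠ 0 := by positivity
    rw [sub_add_cancel]
    field_simp
    ring

theorem RatComputable.mul {F G : α → ℝ} (hF : RatComputable F) (hG : RatComputable G) :
    RatComputable fun a => F a * G a := by
  obtain ⟨c, hc, h⟩ := hF
  obtain ⟨d, hd, h'⟩ := hG
  have hc1 := Computable.fst.comp hc
  have hd1 := Computable.fst.comp hd
  have hc2 := Computable.snd.comp hc
  have hd2 := Computable.snd.comp hd
  have hc3 := Computable.fst.comp hc2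
  have hd3 := Computable.fst.comp hd2
  have hcd := (Computable.snd.comp hc2).natAdd (Computable.const 1)
  have hdd := (Computable.snd.comp hd2).natAdd (Computable.const 1)
  refine ⟨fun a => ((c a).1 * (d a).1 + (c a).2.1 * (d a).2.1,
    (c a).1 * (d a).2.1 + (c a).2.1 * (d a).1,
    ((c a).2.2 + 1) * ((d a).2.2 + 1) - 1), ?_, fun a => ?_⟩
  · exact ((hc1.natMul hd1).natAdd (hc3.natMul hd3)).pair
      (((hc1.natMul hd3).natAdd (hc3.natMul hd1)).pair
        ((hcd.natMul hdd).natSub (Computable.const 1)))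
  · beta_reduce
    rw [← h, ← h']
    simp only [RatCode.val]
    rw [Nat.cast_sub (Nat.mul_pos (Nat.succ_pos _) (Nat.succ_pos _))]
    push_cast
    have h1 : ((c a).2.2 : ℝ) + 1 ≠ 0 := by positivity
    have h2 : ((d a).2.2 : ℝ) + 1 ≠ 0 := by positivity
    rw [sub_add_cancel]
    field_simp
    ring

theorem RatComputable.sub {F G : α → ℝ} (hF : RatComputable F) (hG : RatComputable G) :
    RatComputable fun a => F a - G a := by
  simpa only [sub_eq_add_neg] using hF.add hG.neg

theorem RatComputable.sq {F : α → ℝ} (hF : RatComputable F) : RatComputable fun a => F a ^ 2 := by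
  simpa only [pow_two] using hF.mul hF

theorem RatComputable.half_pow {f : α → ℕ} (hf : Computable f) :
    RatComputable fun a => (1 / 2 : ℝ) ^ f a := by
  refine ⟨fun a => (1, 0, 2 ^ f a - 1),
    (Computable.const 1).pair ((Computable.const 0).pair (hf.two_pow.natSub (Computable.const 1))),
    fun a => ?_⟩
  simp only [RatCode.val]
  rw [Nat.cast_sub Nat.one_le_two_pow]
  simp

theorem RatComputable.lt {F G : α → ℝ} (hF : RatComputable F) (hG : RatComputable G) :
    ComputablePred fun a => F a < G a := by
  classical
  obtain ⟨c, hc, h⟩ := hF.sub hG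
  beta_reduce at h
  have h0 : ComputablePred fun a => (c a).1 < (c a).2.1 := by
    refine Computable.computablePred ?_
    exact (Primrec.nat_lt.decide.to_comp.comp (Computable.fst.comp hc)
      (Computable.fst.comp (Computable.snd.comp hc))).of_eq fun a => by congr
  refine h0.of_eq fun a => ?_
  rw [← sub_neg (a := F a), ← h, RatCode.val, div_neg_iff, ← Nat.cast_lt (α := ℝ)]
  have h1 : 0 < ((c a).2.2 : ℝ) + 1 := by positivity
  constructor
  · intro h2
    right
    exact ⟨by linarith, h1⟩
  · rintro (h2 | h2) <;> linarith [h2.1, h2.2]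

theorem RatComputable.le {F G : α → ℝ} (hF : RatComputable F) (hG : RatComputable G) :
    ComputablePred fun a => F a ≤ G a :=
  (hG.lt hF).not.of_eq fun _ => not_lt

theorem RatComputable.eq {F G : α → ℝ} (hF : RatComputable F) (hG : RatComputable G) :
    ComputablePred fun a => F a = G a :=
  ((hF.le hG).and (hG.le hF)).of_eq fun _ => le_antisymm_iff.symm

theorem RatCode.exists_val_eq (q : ℚ) : ∃ c : RatCode, c.val = (q : ℝ) := by
  refine ⟨(q.num.toNat, (-q.num).toNat, q.den - 1), ?_⟩
  simp only [RatCode.val]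
  rw [Nat.cast_sub q.pos, Nat.cast_one, sub_add_cancel, Rat.cast_def]
  congr 1
  have := Int.toNat_sub_toNat_neg q.num
  exact_mod_cast this

theorem RatCode.exists_rat_eq (c : RatCode) : ∃ q : ℚ, (q : ℝ) = c.val :=
  ⟨((c.1 : ℚ) - c.2.1) / (c.2.2 + 1), by simp [RatCode.val]⟩

theorem RatCode.exists_between {x y : ℝ} (h : x < y) : ∃ c : RatCode, x < c.val ∧ c.val < y := by
  obtain ⟨q, h1, h2⟩ := exists_rat_btwn h
  obtain ⟨c, hc⟩ := RatCode.exists_val_eq q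
  exact ⟨c, hc ▸ h1, hc ▸ h2⟩

end RatComputable

/-! ### Injective parametrizations and arc length -/

/-- A continuous injection of the compact interval is a homeomorphism onto `S`, so `f⁻¹ ∘ g` is
continuous. -/
theorem IsInjParam.exists_lift {f : ℝ → Plane} {a b : ℝ} {S : Set Plane} (hf : IsInjParam f a b S)
    {g : ℝ → Plane} {K : Set ℝ} (hg : ContinuousOn g K) (hgS : MapsTo g K S) :
    ∃ φ : ℝ → ℝ, ContinuousOn φ K ∧ MapsTo φ K (Icc a b) ∧ ∀ x ∈ K, f (φ x) = g x := by
  obtain ⟨-, hfc, hfi, hfS⟩ := hf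
  have h : ∀ x, ∃ y, x ∈ K → y ∈ Icc a b ∧ f y = g x := by
    intro x
    by_cases hx : x ∈ K
    · obtain ⟨y, hy, hxy⟩ := hfS.symm ▸ hgS hx
      exact ⟨y, fun _ => ⟨hy, hxy⟩⟩
    · exact ⟨0, fun h => absurd h hx⟩
  choose φ hφ using h
  refine ⟨φ, ?_, fun x hx => (hφ x hx).1, fun x hx => (hφ x hx).2⟩
  have hemb : IsClosedEmbedding fun x : Icc a b => f x :=
    Continuous.isClosedEmbedding (continuousOn_iff_continuous_domRestrict.1 hfc)
      (injOn_iff_injective.1 hfi)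
  rw [continuousOn_iff_continuous_domRestrict]
  have h : Continuous fun x : K => (⟨φ x, (hφ x x.2).1⟩ : Icc a b) := by
    rw [hemb.isInducing.continuous_iff]
    exact (continuousOn_iff_continuous_domRestrict.1 hg).congr fun x => ((hφ x x.2).2).symm
  exact continuous_subtype_val.comp h

/-- The change of parameter is a continuous injection between intervals, hence strictly monotone or
antitone, and variation is invariant under both. -/
theorem IsInjParam.eVariationOn_eq {f g : ℝ → Plane} {a b c d : ℝ} {S : Set Plane}
    (hf : IsInjParam f a b S) (hg : IsInjParam g c d S) :
    eVariationOn f (Icc a b) = eVariationOn g (Icc c d) := by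
  obtain ⟨φ, hφc, hφm, hφ⟩ := hf.exists_lift hg.2.1 (hg.2.2.2 ▸ mapsTo_image _ _)
  have hinj : InjOn φ (Icc c d) := fun x hx y hy hxy =>
    hg.2.2.1 hx hy (by rw [← hφ x hx, ← hφ y hy, hxy])
  have hsurj : φ '' Icc c d = Icc a b := by
    refine hφm.image_subset.antisymm fun y hy => ?_
    obtain ⟨x, hx, hxy⟩ : f y ∈ g '' Icc c d := by
      rw [hg.2.2.2, ← hf.2.2.2]
      exact mem_image_of_mem f hy
    exact ⟨x, hx, hf.2.2.1 (hφm hx) hy ((hφ x hx).trans hxy)⟩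
  rw [← hsurj, ← eVariationOn.congr (f := f ∘ φ) (g := g) hφ]
  rcases hφc.strictMonoOn_of_injOn_Icc' hg.1 hinj with h | h
  · exact (eVariationOn.comp_eq_of_monotoneOn f φ h.monotoneOn).symm
  · exact (eVariationOn.comp_eq_of_antitoneOn f φ h.antitoneOn).symm

theorem IsInjParam.arcLength_eq {f : ℝ → Plane} {a b : ℝ} {S : Set Plane}
    (hf : IsInjParam f a b S) : arcLength S = eVariationOn f (Icc a b) := by
  refine le_antisymm ?_ ?_
  · exact iInf_le_of_le f (iInf_le_of_le a (iInf_le_of_le b (iInf_le _ hf)))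
  · exact le_iInf fun g => le_iInf fun c => le_iInf fun d => le_iInf fun hg =>
      (hf.eVariationOn_eq hg).le

theorem isInjParam_image {f : ℝ → Plane} {a b : ℝ} (hab : a ≤ b) (hc : ContinuousOn f (Icc a b))
    (hi : InjOn f (Icc a b)) : IsInjParam f a b (f '' Icc a b) := ⟨hab, hc, hi, rfl⟩

/-! ### Functions whose initial images grow strictly -/

/-- Were `u y` strictly between two earlier values, then by continuity so would be all values just
before `y`. The intermediate value theorem says these were already taken, so the initial image would
not grow there. -/
theorem extremal_of_image_Icc_ne {u : ℝ → ℝ} {a b : ℝ} (hu : ContinuousOn u (Icc a b))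
    (hne : ∀ x ∈ Icc a b, ∀ y ∈ Icc a b, x < y → u '' Icc a x ≠ u '' Icc a y)
    {y : ℝ} (hy : y ∈ Icc a b) :
    (∀ x ∈ Icc a y, u x ≤ u y) ∨ ∀ x ∈ Icc a y, u y ≤ u x := by
  by_contra! h
  obtain ⟨⟨p, hp, hup⟩, q, hq, huq⟩ := h
  have hpy : p < y := lt_of_le_of_ne hp.2 (by rintro rfl; exact hup.false)
  have hqy : q < y := lt_of_le_of_ne hq.2 (by rintro rfl; exact huq.false)
  have hev : ∀ᶠ z in 𝓝[Icc a b] y, u z ∈ Ioo (u q) (u p) :=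
    (hu y hy).eventually (Ioo_mem_nhds huq hup)
  obtain ⟨δ, hδ, hball⟩ := Metric.mem_nhdsWithin_iff.1 hev
  have hm : max (max p q) (y - δ) < y := max_lt (max_lt hpy hqy) (by linarith)
  obtain ⟨z, hz, hzy⟩ := exists_between hm
  have hpz : p < z := (le_max_left _ _).trans_lt ((le_max_left _ _).trans_lt hz)
  have hqz : q < z := (le_max_right _ _).trans_lt ((le_max_left _ _).trans_lt hz)
  have hδz : y - δ < z := (le_max_right _ _).trans_lt hz
  have haz : a ≤ z := hp.1.trans hpz.le
  refine hne z ⟨haz, hzy.le.trans hy.2⟩ y hy hzy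
    ((image_mono (Icc_subset_Icc_right hzy.le)).antisymm ?_)
  rintro _ ⟨w, hw, rfl⟩
  rcases le_or_gt w z with hwz | hwz
  · exact ⟨w, ⟨hw.1, hwz⟩, rfl⟩
  · have hwI : u w ∈ Ioo (u q) (u p) := by
      refine hball ⟨?_, hw.1, hw.2.trans hy.2⟩
      rw [Metric.mem_ball, Real.dist_eq, abs_lt]
      constructor <;> linarith [hw.2]
    have hsub : uIcc q p ⊆ Icc a z := uIcc_subset_Icc ⟨hq.1, hqz.le⟩ ⟨hp.1, hpz.le⟩
    have hivt := intermediate_value_uIcc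
      (hu.mono (hsub.trans (Icc_subset_Icc_right (hzy.le.trans hy.2))))
    exact image_mono hsub (hivt (Icc_subset_uIcc ⟨hwI.1.le, hwI.2.le⟩))

theorem injOn_of_image_Icc_ne {u : ℝ → ℝ} {a b : ℝ} (hu : ContinuousOn u (Icc a b))
    (hne : ∀ x ∈ Icc a b, ∀ y ∈ Icc a b, x < y → u '' Icc a x ≠ u '' Icc a y) :
    InjOn u (Icc a b) := by
  have hext := fun y hy => extremal_of_image_Icc_ne hu hne (y := y) hy
  have key : ∀ x ∈ Icc a b, ∀ y ∈ Icc a b, x < y → u x ≠ u y := by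
    intro x hx y hy hxy hu_eq
    -- If `u` were constant between `x` and `y`, the initial image would not grow.
    obtain ⟨z, hzx, hzy, hzu⟩ : ∃ z, x < z ∧ z < y ∧ u z ≠ u x := by
      by_contra! hcon
      refine hne x hx y hy hxy ((image_mono (Icc_subset_Icc_right hxy.le)).antisymm ?_)
      rintro _ ⟨w, hw, rfl⟩
      rcases le_or_gt w x with h | h
      · exact ⟨w, ⟨hw.1, h⟩, rfl⟩
      · refine ⟨x, ⟨hx.1, le_rfl⟩, ?_⟩
        rcases hw.2.lt_or_eq with h' | h'
        · exact (hcon w h h').symm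
        · rw [h', hu_eq]
    have hsub : Icc z y ⊆ Icc a b := Icc_subset_Icc (hx.1.trans hzx.le) hy.2
    -- The earlier values `u x = u y` and `u z` lie strictly on opposite sides of `u w`, so `u w` is
    -- not extremal on `Icc a w`.
    have hmid : ∃ w ∈ Icc z y, u w = (u z + u y) / 2 := by
      have hivt := intermediate_value_uIcc (f := u) (a := z) (b := y)
        (by rw [uIcc_of_le hzy.le]; exact hu.mono hsub)
      rw [uIcc_of_le hzy.le] at hivt
      refine hivt ?_
      rw [mem_uIcc]
      rcases le_total (u z) (u y) with h | h
      · left; constructor <;> linarith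
      · right; constructor <;> linarith
    obtain ⟨w, hw, hwu⟩ := hmid
    have hx' : x ∈ Icc a w := ⟨hx.1, hzx.le.trans hw.1⟩
    have hz' : z ∈ Icc a w := ⟨hx.1.trans hzx.le, hw.1⟩
    rcases hext w (hsub hw) with h | h
    · have h1 := h x hx'
      have h2 := h z hz'
      exact hzu (by linarith)
    · have h1 := h x hx'
      have h2 := h z hz'
      exact hzu (by linarith)
  intro x hx y hy hxy
  rcases lt_trichotomy x y with h | h | h
  · exact absurd hxy (key x hx y hy h)
  · exact h
  · exact absurd hxy.symm (key y hy x hx h)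

/-! ### Length-normalized parametrizations -/

/-- `f` parametrizes `C` injectively on `[0, 1]`, with constant speed `l`. -/
structure IsConstSpeedParam (f : ℝ → Plane) (l : ℝ) (C : Set Plane) : Prop where
  isInjParam : IsInjParam f 0 1 C
  pos : 0 < l
  eVariationOn_eq : ∀ s t : ℝ, 0 ≤ s → s ≤ t → t ≤ 1 →
    eVariationOn f (Icc s t) = ENNReal.ofReal (l * (t - s))

theorem IsSimpleCurve.arcLength_ne_zero {C : Set Plane} (hC : IsSimpleCurve C) :
    arcLength C ≠ 0 := by
  obtain ⟨f, hf⟩ := hC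
  rw [hf.arcLength_eq]
  intro h0
  have h1 := eVariationOn.edist_le f (s := Icc (0 : ℝ) 1) (x := 0) (y := 1) (by simp) (by simp)
  rw [h0, nonpos_iff_eq_zero, edist_eq_zero] at h1
  exact zero_ne_one (hf.2.2.1 (by simp) (by simp) h1)

/-- Normalization prescribes only the lengths of the initial images, so injectivity has to be
derived. Different `t` give different lengths, hence different initial images. Lifting `f` through
an injective parametrization turns this into `injOn_of_image_Icc_ne`. -/
theorem isConstSpeedParam_of_arcLength {f : ℝ → Plane} {C : Set Plane} (hC : IsSimpleCurve C)
    (hr : IsRectifiable C) (hf : ContinuousOn f (Icc 0 1)) (hfC : f '' Icc 0 1 = C)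
    (hl : ∀ t ∈ Icc (0 : ℝ) 1, arcLength (f '' Icc 0 t) = ENNReal.ofReal t * arcLength C) :
    IsConstSpeedParam f (arcLength C).toReal C := by
  have hl0 := hC.arcLength_ne_zero
  obtain ⟨g, hg⟩ := hC
  obtain ⟨u, huc, hum, hu⟩ := hg.exists_lift hf (hfC ▸ mapsTo_image _ _)
  have himg : ∀ x ∈ Icc (0 : ℝ) 1, f '' Icc 0 x = g '' (u '' Icc 0 x) := by
    intro x hx
    rw [image_image]
    exact image_congr fun y hy => (hu y ⟨hy.1, hy.2.trans hx.2⟩).symm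
  have hui : InjOn u (Icc 0 1) := by
    refine injOn_of_image_Icc_ne huc fun x hx y hy hxy h => ?_
    have h1 := hl x hx
    rw [himg x hx, h, ← himg y hy, hl y hy, ENNReal.mul_left_inj hl0 hr,
      ENNReal.ofReal_eq_ofReal_iff hy.1 hx.1] at h1
    exact hxy.ne h1.symm
  have hfi : InjOn f (Icc 0 1) := fun x hx y hy hxy =>
    hui hx hy (hg.2.2.1 (hum hx) (hum hy) (by rw [hu x hx, hu y hy, hxy]))
  have hv : ∀ t ∈ Icc (0 : ℝ) 1, eVariationOn f (Icc 0 t) = ENNReal.ofReal t * arcLength C := by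
    intro t ht
    have hsub : Icc 0 t ⊆ Icc (0 : ℝ) 1 := Icc_subset_Icc_right ht.2
    rw [← hl t ht, (isInjParam_image ht.1 (hf.mono hsub) (hfi.mono hsub)).arcLength_eq]
  refine ⟨⟨zero_le_one, hf, hfi, hfC⟩, ENNReal.toReal_pos hl0 hr, fun s t h0 hst h1 => ?_⟩
  have hadd := eVariationOn.Icc_add_Icc f (s := univ) h0 hst (mem_univ _)
  simp only [univ_inter] at hadd
  rw [hv s ⟨h0, hst.trans h1⟩, hv t ⟨h0.trans hst, h1⟩] at hadd
  have hs : ENNReal.ofReal s * arcLength C ≠ ⊤ := ENNReal.mul_ne_top ENNReal.ofReal_ne_top hr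
  rw [← ENNReal.add_right_inj hs, hadd]
  conv_lhs => rw [← ENNReal.ofReal_toReal hr, ← ENNReal.ofReal_mul (h0.trans hst)]
  conv_rhs => rw [← ENNReal.ofReal_toReal hr, ← ENNReal.ofReal_mul h0, ENNReal.toReal_ofReal
    ENNReal.toReal_nonneg, ← ENNReal.ofReal_add (mul_nonneg h0 ENNReal.toReal_nonneg)
      (mul_nonneg ENNReal.toReal_nonneg (sub_nonneg.2 hst))]
  congr 1
  ring

namespace IsConstSpeedParam

variable {f : ℝ → Plane} {l : ℝ} {C : Set Plane}

theorem arcLength_image (h : IsConstSpeedParam f l C) {s t : ℝ} (h0 : 0 ≤ s) (hst : s ≤ t)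
    (h1 : t ≤ 1) : arcLength (f '' Icc s t) = ENNReal.ofReal (l * (t - s)) := by
  have hsub : Icc s t ⊆ Icc (0 : ℝ) 1 := Icc_subset_Icc h0 h1
  rw [← h.eVariationOn_eq s t h0 hst h1]
  exact (isInjParam_image hst (h.isInjParam.2.1.mono hsub)
    (h.isInjParam.2.2.1.mono hsub)).arcLength_eq

theorem dist_le (h : IsConstSpeedParam f l C) {x y : ℝ} (hx : x ∈ Icc (0 : ℝ) 1)
    (hy : y ∈ Icc (0 : ℝ) 1) : dist (f x) (f y) ≤ l * |x - y| := by
  wlog hxy : x ≤ y generalizing x y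
  · rw [dist_comm, abs_sub_comm]
    exact this hy hx (le_of_not_ge hxy)
  have h1 := eVariationOn.edist_le f (s := Icc x y) (left_mem_Icc.2 hxy) (right_mem_Icc.2 hxy)
  rw [h.eVariationOn_eq x y hx.1 hxy hy.2, edist_dist,
    ENNReal.ofReal_le_ofReal_iff (mul_nonneg h.pos.le (sub_nonneg.2 hxy))] at h1
  rwa [abs_sub_comm, abs_of_nonneg (sub_nonneg.2 hxy)]

/-- The length is the least Lipschitz constant. -/
theorem exists_lt_dist (h : IsConstSpeedParam f l C) {q : ℝ} (hq0 : 0 ≤ q) (hq : q < l) :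
    ∃ x ∈ Icc (0 : ℝ) 1, ∃ y ∈ Icc (0 : ℝ) 1, x < y ∧ q * (y - x) < dist (f x) (f y) := by
  by_contra! hcon
  -- If no chord beats slope `q`, then `f` is `q`-Lipschitz and its variation `l` is at most `q`.
  have hlip : LipschitzOnWith ⟨q, hq0⟩ f (Icc 0 1) := by
    refine LipschitzOnWith.of_dist_le_mul fun x hx y hy => ?_
    show dist (f x) (f y) ≤ q * dist x y
    rcases lt_trichotomy x y with hxy | hxy | hxy
    · rw [dist_comm x y, Real.dist_eq, abs_of_pos (sub_pos.2 hxy)]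
      exact hcon x hx y hy hxy
    · simp [hxy]
    · rw [dist_comm (f x), Real.dist_eq, abs_of_pos (sub_pos.2 hxy)]
      exact hcon y hy x hx hxy
  have h1 := hlip.comp_eVariationOn_le (g := id) (s := Icc 0 1) (mapsTo_id _)
  have h2 := ((monotoneOn_id (s := Icc (0 : ℝ) 1)).eVariationOn_eq (a := 0) (b := 1)
    (by simp) (by simp)).le
  rw [inter_self] at h2
  have h3 : eVariationOn f (Icc 0 1) ≤ ENNReal.ofReal q := by
    refine h1.trans ((mul_le_mul_right h2 _).trans_eq ?_)
    rw [id, id, sub_zero, ENNReal.ofReal_one, mul_one, ENNReal.ofReal, Real.toNNReal_of_nonneg hq0]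
    rfl
  rw [h.eVariationOn_eq 0 1 le_rfl zero_le_one le_rfl, sub_zero, mul_one,
    ENNReal.ofReal_le_ofReal_iff hq0] at h3
  exact hq.not_ge h3

/-- A segment may come from any injective parametrization `g`. Lifting `g` through `f` sends `Icc a
b` onto a compact interval, which is nondegenerate because `g` is injective. -/
theorem exists_segment_eq (h : IsConstSpeedParam f l C) {S : Set Plane}
    (hS : IsNontrivialSegment S C) :
    ∃ s t : ℝ, 0 ≤ s ∧ s < t ∧ t ≤ 1 ∧ S = f '' Icc s t := by
  obtain ⟨g, hg, a, b, ha, hab, hb, rfl⟩ := hS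
  have hsub : Icc a b ⊆ Icc 0 1 := Icc_subset_Icc ha hb
  obtain ⟨φ, hφc, hφm, hφ⟩ := h.isInjParam.exists_lift hg.2.1 (hg.2.2.2 ▸ mapsTo_image _ _)
  have himg := (hφc.mono hsub).image_Icc hab.le
  set s := sInf (φ '' Icc a b)
  set t := sSup (φ '' Icc a b)
  have hφa : φ a ∈ Icc s t := himg ▸ mem_image_of_mem φ (left_mem_Icc.2 hab.le)
  have hφb : φ b ∈ Icc s t := himg ▸ mem_image_of_mem φ (right_mem_Icc.2 hab.le)
  have hst : Icc s t ⊆ Icc 0 1 := by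
    rw [← himg]
    exact (image_mono hsub).trans hφm.image_subset
  have hle : s ≤ t := hφa.1.trans hφa.2
  refine ⟨s, t, (hst (left_mem_Icc.2 hle)).1, lt_of_le_of_ne hle fun heq => ?_,
    (hst (right_mem_Icc.2 hle)).2, ?_⟩
  · rw [← heq, Icc_self, mem_singleton_iff] at hφa hφb
    have ha' := hsub (left_mem_Icc.2 hab.le)
    have hb' := hsub (right_mem_Icc.2 hab.le)
    refine hab.ne (hg.2.2.1 ha' hb' ?_)
    rw [← hφ a ha', ← hφ b hb', hφa, hφb]
  · rw [← himg, image_image]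
    exact image_congr fun x hx => (hφ x (hsub hx)).symm

end IsConstSpeedParam

/-! ### Polygon functions -/

namespace IsRationalPolygonFun

variable {L : List RatTriple} {p : ℝ → Plane}

theorem knot_lt (h : IsRationalPolygonFun L p) {i : ℕ} (hi : i + 1 < L.length) :
    L[i].knot < L[i + 1].knot := by
  have := List.pairwise_iff_getElem.1 h.1 i (i + 1) (by simpa using by omega) (by simpa using hi)
    (by omega)
  simpa using this

theorem exists_mem_Icc (h : IsRationalPolygonFun L p) {t : ℝ} (ht : t ∈ Icc (0 : ℝ) 1) :
    ∃ (i : ℕ) (hi : i + 1 < L.length), t ∈ Icc L[i].knot L[i + 1].knot := by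
  obtain ⟨-, hhead, hlast, -⟩ := id h
  have hlen : 0 < L.length := by
    rcases L with _ | ⟨a, L⟩
    · simp at hhead
    · simp
  have h0 : L[0].knot = 0 := by
    rw [List.head?_eq_getElem?, List.getElem?_eq_getElem (by simpa using hlen)] at hhead
    simpa using hhead
  have h1 : L[L.length - 1].knot = 1 := by
    rw [List.getLast?_eq_getElem?, List.getElem?_eq_getElem (by simpa using by omega)] at hlast
    simpa using hlast
  classical
  have hex : ∃ j, ∃ hj : j < L.length, t ≤ L[j].knot :=
    ⟨L.length - 1, by omega, h1 ▸ ht.2⟩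
  obtain ⟨hj, htj⟩ := Nat.find_spec hex
  have hmin := fun m => Nat.find_min hex (m := m)
  generalize Nat.find hex = j at hj htj hmin
  -- If the first knot not below `t` is knot `0`, then `t = 0` and the first interval serves. It
  -- exists since the first and last knots, `0` and `1`, differ.
  rcases j with _ | i
  · have hlen2 : 1 < L.length := by
      by_contra hcon
      have hl : L.length - 1 = 0 := by omega
      simp only [hl, h0] at h1
      exact zero_ne_one h1
    refine ⟨0, hlen2, h0 ▸ ht.1, htj.trans (h.knot_lt hlen2).le⟩
  · refine ⟨i, hj, ?_, htj⟩
    by_contra hcon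
    exact hmin i (Nat.lt_succ_self i) ⟨by omega, (not_le.1 hcon).le⟩

theorem apply_eq (h : IsRationalPolygonFun L p) {i : ℕ} (hi : i + 1 < L.length) {t : ℝ}
    (ht : t ∈ Icc L[i].knot L[i + 1].knot) :
    p t = AffineMap.lineMap L[i].vertex L[i + 1].vertex
      ((t - L[i].knot) / (L[i + 1].knot - L[i].knot)) := by
  have hd := sub_pos.2 (h.knot_lt hi)
  rw [← h.2.2.2 i hi]
  · congr 1
    rw [AffineMap.lineMap_apply_ring']
    field_simp
    ring
  · exact ⟨div_nonneg (sub_nonneg.2 ht.1) hd.le,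
      (div_le_one hd).2 (sub_le_sub_right ht.2 _)⟩

theorem continuousOn (h : IsRationalPolygonFun L p) : ContinuousOn p (Icc 0 1) := by
  have hcover : Icc (0 : ℝ) 1 ⊆
      ⋃ i : Fin (L.length - 1), Icc (L[(i : ℕ)]'(by omega)).knot (L[(i : ℕ) + 1]'(by omega)).knot := by
    intro t ht
    obtain ⟨i, hi, hti⟩ := h.exists_mem_Icc ht
    exact mem_iUnion.2 ⟨⟨i, by omega⟩, hti⟩
  refine ContinuousOn.mono ?_ hcover
  refine (locallyFinite_of_finite _).continuousOn_iUnion (fun _ => isClosed_Icc) fun i => ?_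
  refine ContinuousOn.congr (f := fun t => AffineMap.lineMap (L[(i : ℕ)]'(by omega)).vertex
    (L[(i : ℕ) + 1]'(by omega)).vertex ((t - (L[(i : ℕ)]'(by omega)).knot) /
      ((L[(i : ℕ) + 1]'(by omega)).knot - (L[(i : ℕ)]'(by omega)).knot))) ?_
    fun t ht => h.apply_eq (by omega) ht
  exact (AffineMap.lineMap_continuous.comp (by fun_prop)).continuousOn

end IsRationalPolygonFun

theorem IsComputableFun.continuousOn {f : ℝ → Plane} (hf : IsComputableFun f) :
    ContinuousOn f (Icc 0 1) := by
  obtain ⟨L, -, p, hp⟩ := hf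
  have hu : TendstoUniformlyOn p f atTop (Icc 0 1) := by
    rw [Metric.tendstoUniformlyOn_iff]
    intro ε hε
    have := (tendsto_pow_atTop_nhds_zero_of_lt_one (r := (1 / 2 : ℝ)) (by norm_num)
      (by norm_num)).eventually (gt_mem_nhds hε)
    filter_upwards [this] with n hn t ht
    exact ((hp n).2 t ht).trans_lt hn
  exact hu.continuousOn (Frequently.of_forall fun n => (hp n).1.continuousOn)

/-! ### Rational approximations of computable functions -/

/-- The point of the plane with the given rational coordinates. -/
noncomputable def ratPoint (z : RatCode × RatCode) : Plane := !₂[z.1.val, z.2.val]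

theorem dist_ratPoint_sq (z w : RatCode × RatCode) :
    dist (ratPoint z) (ratPoint w) ^ 2 = (z.1.val - w.1.val) ^ 2 + (z.2.val - w.2.val) ^ 2 := by
  rw [EuclideanSpace.dist_eq, Real.sq_sqrt (Finset.sum_nonneg fun _ _ => sq_nonneg _)]
  simp [ratPoint, Real.dist_eq, sq_abs]

theorem RatComputable.dist_sq {α : Type*} [Primcodable α] {z w : α → RatCode × RatCode}
    (hz : Computable z) (hw : Computable w) :
    RatComputable fun a => dist (ratPoint (z a)) (ratPoint (w a)) ^ 2 := by
  simp only [dist_ratPoint_sq]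
  exact (((Computable.fst.comp hz).ratComputable.sub (Computable.fst.comp hw).ratComputable).sq).add
    (((Computable.snd.comp hz).ratComputable.sub (Computable.snd.comp hw).ratComputable).sq)

theorem Computable.listGetD {α β : Type*} [Primcodable α] [Primcodable β] {l : α → List β}
    {i : α → ℕ} (d : β) (hl : Computable l) (hi : Computable i) :
    Computable fun a => (l a).getD (i a) d :=
  (Primrec.list_getD d).to_comp.comp hl hi

theorem exists_ratPoint_eq_lineMap (v w : RatCode × RatCode) {s : ℝ} (hs : ∃ q : ℚ, (q : ℝ) = s) :
    ∃ z, ratPoint z = AffineMap.lineMap (ratPoint v) (ratPoint w) s := by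
  obtain ⟨q, rfl⟩ := hs
  have h : ∀ c d : RatCode, ∃ e : RatCode, e.val = AffineMap.lineMap c.val d.val (q : ℝ) := by
    intro c d
    obtain ⟨c', hc⟩ := c.exists_rat_eq
    obtain ⟨d', hd⟩ := d.exists_rat_eq
    obtain ⟨e, he⟩ := RatCode.exists_val_eq (q * (d' - c') + c')
    refine ⟨e, ?_⟩
    rw [he, ← hc, ← hd, AffineMap.lineMap_apply_ring']
    push_cast
    ring
  obtain ⟨e₁, h₁⟩ := h v.1 w.1
  obtain ⟨e₂, h₂⟩ := h v.2 w.2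
  refine ⟨(e₁, e₂), ?_⟩
  ext i
  fin_cases i <;> simp [ratPoint, h₁, h₂, AffineMap.lineMap_apply]

/-- The polygon value at a rational parameter is rational and determined by decidable equations, so
it can be found by search, with no need to compute quotients. -/
theorem IsComputableFun.exists_approx {f : ℝ → Plane} (hf : IsComputableFun f) :
    ∃ a : ℕ × RatCode → RatCode × RatCode, Computable a ∧
      ∀ n (r : RatCode), r.val ∈ Icc (0 : ℝ) 1 →
        dist (f r.val) (ratPoint (a (n, r))) ≤ (1 / 2 : ℝ) ^ n := by
  obtain ⟨L, hL, p, hp⟩ := hf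
  let V : ℕ → ℕ → RatTriple := fun n i => (L n).getD i default
  -- The affine interpolation formula with denominators cleared. The first disjunct accepts anything
  -- outside the unit interval, so that the search always terminates.
  let R : ℕ × RatCode → RatCode × RatCode → Prop := fun x z =>
    (x.2.val < 0 ∨ 1 < x.2.val) ∨ ∃ i : ℕ, i + 1 < (L x.1).length ∧
      ((V x.1 i).1.val ≤ x.2.val ∧ x.2.val ≤ (V x.1 (i + 1)).1.val) ∧
      (z.1.val - (V x.1 i).2.1.val) * ((V x.1 (i + 1)).1.val - (V x.1 i).1.val) =
        (x.2.val - (V x.1 i).1.val) * ((V x.1 (i + 1)).2.1.val - (V x.1 i).2.1.val) ∧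
      (z.2.val - (V x.1 i).2.2.val) * ((V x.1 (i + 1)).1.val - (V x.1 i).1.val) =
        (x.2.val - (V x.1 i).1.val) * ((V x.1 (i + 1)).2.2.val - (V x.1 i).2.2.val)
  have hR : Semidecidable fun y : (ℕ × RatCode) × (RatCode × RatCode) => R y.1 y.2 := by
    refine Semidecidable.or (ComputablePred.semidecidable ?_) (Semidecidable.exists_nat
      (ComputablePred.semidecidable ?_))
    · have hr : RatComputable fun y : (ℕ × RatCode) × (RatCode × RatCode) => y.1.2.val :=
        (Computable.snd.comp Computable.fst).ratComputable
      exact (hr.lt (by simpa using RatComputable.const_nat 0)).or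
        (RatComputable.lt (by simpa using RatComputable.const_nat 1) hr)
    · have hx : Computable fun y : ((ℕ × RatCode) × (RatCode × RatCode)) × ℕ => y.1.1 :=
        Computable.fst.comp Computable.fst
      have hz : Computable fun y : ((ℕ × RatCode) × (RatCode × RatCode)) × ℕ => y.1.2 :=
        Computable.snd.comp Computable.fst
      have hLx := hL.comp (Computable.fst.comp hx)
      have hi : Computable fun y : ((ℕ × RatCode) × (RatCode × RatCode)) × ℕ => y.2 :=
        Computable.snd
      have hi' := hi.natAdd (Computable.const 1)
      have hv := Computable.listGetD default hLx hi
      have hv' := Computable.listGetD default hLx hi'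
      have hr := (Computable.snd.comp hx).ratComputable
      have hz1 := (Computable.fst.comp hz).ratComputable
      have hz2 := (Computable.snd.comp hz).ratComputable
      have hk := (Computable.fst.comp hv).ratComputable
      have hk' := (Computable.fst.comp hv').ratComputable
      have ha := (Computable.fst.comp (Computable.snd.comp hv)).ratComputable
      have ha' := (Computable.fst.comp (Computable.snd.comp hv')).ratComputable
      have hb := (Computable.snd.comp (Computable.snd.comp hv)).ratComputable
      have hb' := (Computable.snd.comp (Computable.snd.comp hv')).ratComputable
      refine ComputablePred.and ?_ (((hk.le hr).and (hr.le hk')).and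
        ((((hz1.sub ha).mul (hk'.sub hk)).eq ((hr.sub hk).mul (ha'.sub ha))).and
          (((hz2.sub hb).mul (hk'.sub hk)).eq ((hr.sub hk).mul (hb'.sub hb)))))
      exact ((RatComputable.natCast hi').lt (RatComputable.natCast
        (Computable.list_length.comp hLx))).of_eq fun _ => Nat.cast_lt
  have hex : ∀ x, ∃ z, R x z := by
    rintro ⟨n, r⟩
    by_cases hr : r.val ∈ Icc (0 : ℝ) 1
    · obtain ⟨i, hi, hri⟩ := (hp n).1.exists_mem_Icc hr
      have hi0 : i < (L n).length := by omega
      have hV : V n i = (L n)[i] := List.getD_eq_getElem _ _ hi0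
      have hV' : V n (i + 1) = (L n)[i + 1] := List.getD_eq_getElem _ _ hi
      have hlt := (hp n).1.knot_lt hi
      have hd : (V n (i + 1)).1.val - (V n i).1.val ≠ 0 := by
        rw [hV, hV']
        exact (sub_pos.2 hlt).ne'
      obtain ⟨z, hz⟩ := exists_ratPoint_eq_lineMap (V n i).2 (V n (i + 1)).2
        (s := (r.val - (V n i).1.val) / ((V n (i + 1)).1.val - (V n i).1.val)) (by
          obtain ⟨q, hq⟩ := r.exists_rat_eq
          obtain ⟨q₁, hq₁⟩ := (V n i).1.exists_rat_eq
          obtain ⟨q₂, hq₂⟩ := (V n (i + 1)).1.exists_rat_eq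
          exact ⟨(q - q₁) / (q₂ - q₁), by push_cast; rw [hq, hq₁, hq₂]⟩)
      have hz0 := congrArg (fun w : Plane => w 0) hz
      have hz1 := congrArg (fun w : Plane => w 1) hz
      simp only [ratPoint, AffineMap.lineMap_apply, vsub_eq_sub, vadd_eq_add, PiLp.add_apply,
        PiLp.smul_apply, PiLp.sub_apply, smul_eq_mul, PiLp.toLp_apply, Matrix.cons_val_zero,
        Matrix.cons_val_one] at hz0 hz1
      refine ⟨z, Or.inr ⟨i, hi, ⟨by rw [hV]; exact hri.1, by rw [hV']; exact hri.2⟩, ?_, ?_⟩⟩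
      · rw [hz0]
        field_simp
        ring
      · rw [hz1]
        field_simp
        ring
    · refine ⟨default, Or.inl ?_⟩
      rw [mem_Icc, not_and_or, not_le, not_le] at hr
      exact hr
  obtain ⟨a, ha, hspec⟩ := hR.exists_computable hex
  refine ⟨a, ha, fun n r hr => ?_⟩
  have hpa : p n r.val = ratPoint (a (n, r)) := by
    rcases hspec (n, r) with (h | h) | ⟨i, hi, hri, hz1, hz2⟩
    · exact absurd hr.1 h.not_ge
    · exact absurd hr.2 h.not_ge
    · have hi0 : i < (L n).length := by
        have : i + 1 < (L n).length := hi
        omega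
      have hV : V n i = (L n)[i] := List.getD_eq_getElem _ _ hi0
      have hV' : V n (i + 1) = (L n)[i + 1] := List.getD_eq_getElem _ _ hi
      simp only [hV, hV'] at hri hz1 hz2
      have hlt := (hp n).1.knot_lt hi
      rw [(hp n).1.apply_eq hi hri]
      have hd : (L n)[i + 1].1.val - (L n)[i].1.val ≠ 0 := (sub_pos.2 hlt).ne'
      have e1 : (a (n, r)).1.val = (L n)[i].2.1.val + (r.val - (L n)[i].1.val) /
          ((L n)[i + 1].1.val - (L n)[i].1.val) * ((L n)[i + 1].2.1.val - (L n)[i].2.1.val) := by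
        field_simp
        linarith
      have e2 : (a (n, r)).2.val = (L n)[i].2.2.val + (r.val - (L n)[i].1.val) /
          ((L n)[i + 1].1.val - (L n)[i].1.val) * ((L n)[i + 1].2.2.val - (L n)[i].2.2.val) := by
        field_simp
        linarith
      ext j
      fin_cases j
      · simp [ratPoint, RatTriple.vertex, RatTriple.knot, AffineMap.lineMap_apply, e1]
        ring
      · simp [ratPoint, RatTriple.vertex, RatTriple.knot, AffineMap.lineMap_apply, e2]
        ring
  rw [← hpa]
  exact (hp n).2 _ hr

/-! ### Computable reals and semidecidable cuts -/

section Cuts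

variable {α : Type*} [Primcodable α]

theorem exists_half_pow_lt {ε : ℝ} (hε : 0 < ε) (c : ℝ) : ∃ n : ℕ, c * (1 / 2 : ℝ) ^ n < ε := by
  have h : Tendsto (fun n : ℕ => c * (1 / 2 : ℝ) ^ n) atTop (𝓝 (c * 0)) :=
    (tendsto_pow_atTop_nhds_zero_of_lt_one (by norm_num) (by norm_num)).const_mul c
  rw [mul_zero] at h
  exact (h.eventually (gt_mem_nhds hε)).exists

theorem IsComputableReal.semidecidable_lt {x : ℝ} (hx : IsComputableReal x) {F : α → ℝ}
    (hF : RatComputable F) : Semidecidable fun a => x < F a := by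
  obtain ⟨c, hc, hdist, hlim⟩ := hx
  have happrox : ∀ n, |(c n).val - x| ≤ 2 * (1 / 2 : ℝ) ^ n := by
    intro n
    have := dist_le_of_le_geometric_of_tendsto (1 / 2) 1 (by norm_num)
      (fun n => by rw [Real.dist_eq, one_mul]; exact hdist n) hlim n
    rw [Real.dist_eq] at this
    refine this.trans_eq ?_
    ring
  have h2 : RatComputable fun _ : α × ℕ => (2 : ℝ) := by simpa using RatComputable.const_nat 2
  refine (Semidecidable.exists_nat (p := fun a n => (c n).val + 2 * (1 / 2 : ℝ) ^ n < F a)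
    (ComputablePred.semidecidable ?_)).of_iff fun a => ⟨?_, fun h => ?_⟩
  · exact ((hc.comp Computable.snd).ratComputable.add
      (h2.mul (RatComputable.half_pow Computable.snd))).lt (hF.comp Computable.fst)
  · rintro ⟨n, hn⟩
    linarith [(abs_le.1 (happrox n)).1]
  · obtain ⟨n, hn⟩ := exists_half_pow_lt (sub_pos.2 h) 4
    exact ⟨n, by linarith [(abs_le.1 (happrox n)).2]⟩

/-- A positive real with semidecidable cuts is computable. -/
theorem isComputableReal_of_semidecidable {x : ℝ} (hx : 0 < x)
    (hlow : Semidecidable fun q : RatCode => 0 ≤ q.val ∧ q.val < x)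
    (hup : Semidecidable fun q : RatCode => x < q.val) : IsComputableReal x := by
  have hp : Semidecidable fun y : ℕ × (RatCode × RatCode) =>
      (0 ≤ y.2.1.val ∧ y.2.1.val < x) ∧ x < y.2.2.val ∧
        y.2.2.val - y.2.1.val < (1 / 2 : ℝ) ^ (y.1 + 1) := by
    have h1 : Computable fun y : ℕ × (RatCode × RatCode) => y.2.1 :=
      Computable.fst.comp Computable.snd
    have h2 : Computable fun y : ℕ × (RatCode × RatCode) => y.2.2 :=
      Computable.snd.comp Computable.snd
    exact (hlow.comp h1).and ((hup.comp h2).and (((h2.ratComputable.sub h1.ratComputable).lt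
      (RatComputable.half_pow (Computable.fst.natAdd (Computable.const 1)))).semidecidable))
  obtain ⟨a, ha, hspec⟩ := Semidecidable.exists_computable
    (p := fun n (z : RatCode × RatCode) => (0 ≤ z.1.val ∧ z.1.val < x) ∧ x < z.2.val ∧
      z.2.val - z.1.val < (1 / 2 : ℝ) ^ (n + 1)) hp (by
    intro n
    have hε : 0 < (1 / 2 : ℝ) ^ (n + 1) / 2 := by positivity
    -- The maximum with `0` is needed because `hlow` confirms only nonnegative lower bounds.
    obtain ⟨q₁, h1, h1'⟩ := RatCode.exists_between
      (max_lt hx (sub_lt_self x hε) : max 0 (x - (1 / 2 : ℝ) ^ (n + 1) / 2) < x)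
    obtain ⟨q₂, h2, h2'⟩ := RatCode.exists_between (lt_add_of_pos_right x hε)
    obtain ⟨h3, h4⟩ := max_lt_iff.1 h1
    exact ⟨(q₁, q₂), ⟨h3.le, h1'⟩, h2, by dsimp only; linarith⟩)
  have hdist : ∀ n, |(a n).1.val - x| ≤ (1 / 2 : ℝ) ^ (n + 1) := by
    intro n
    obtain ⟨⟨-, h1⟩, h2, h3⟩ := hspec n
    rw [abs_le]
    constructor <;> linarith
  refine ⟨fun n => (a n).1, Computable.fst.comp ha, fun n => ?_, ?_⟩
  · have h1 := abs_le.1 (hdist n)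
    have h2 := abs_le.1 (hdist (n + 1))
    have h3 : (0 : ℝ) < (1 / 2) ^ n := by positivity
    simp only [pow_succ] at h1 h2
    rw [abs_le]
    constructor <;> linarith
  · rw [tendsto_iff_dist_tendsto_zero]
    refine squeeze_zero (fun _ => dist_nonneg) hdist ?_
    exact (tendsto_pow_atTop_nhds_zero_of_lt_one (r := (1 / 2 : ℝ)) (by norm_num)
      (by norm_num)).comp (tendsto_add_atTop_nat 1)

end Cuts

/-! ### Sets with semidecidable approximations -/

/-- Rational points near `S` can be enumerated, effectively and up to any given accuracy. -/
def HasEnumerableApprox (S : Set Plane) : Prop :=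
  ∃ A : ℕ → RatCode × RatCode → Prop,
    (Semidecidable fun x : ℕ × (RatCode × RatCode) => A x.1 x.2) ∧
    (∀ n z, A n z → ∃ w ∈ S, dist w (ratPoint z) ≤ 2 * (1 / 2 : ℝ) ^ n) ∧
    ∀ w ∈ S, ∀ n, ∃ z, A n z ∧ dist w (ratPoint z) ≤ 2 * (1 / 2 : ℝ) ^ n

theorem exists_ratCode_near {t : ℝ} (ht : t ∈ Icc (0 : ℝ) 1) {δ : ℝ} (hδ : 0 < δ) :
    ∃ r : RatCode, r.val ∈ Icc (0 : ℝ) 1 ∧ |r.val - t| < δ := by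
  have h : max 0 (t - δ) < min 1 (t + δ) := by
    rw [max_lt_iff, lt_min_iff, lt_min_iff]
    exact ⟨⟨zero_lt_one, by linarith [ht.1]⟩, by linarith [ht.2], by linarith⟩
  obtain ⟨r, h1, h2⟩ := RatCode.exists_between h
  obtain ⟨h1, h1'⟩ := max_lt_iff.1 h1
  obtain ⟨h2, h2'⟩ := lt_min_iff.1 h2
  exact ⟨r, ⟨h1.le, h2.le⟩, abs_lt.2 ⟨by linarith, by linarith⟩⟩

/-- Approximate values at rational parameters are enumerated. One `2 ^ (-n)` pays for the
approximation, the other for moving to a rational parameter. -/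
theorem IsComputableFun.hasEnumerableApprox {f : ℝ → Plane} (hf : IsComputableFun f) :
    HasEnumerableApprox (f '' Icc 0 1) := by
  obtain ⟨a, ha, happrox⟩ := hf.exists_approx
  refine ⟨fun n z => ∃ r : RatCode, (0 ≤ r.val ∧ r.val ≤ 1) ∧ z = a (n, r), ?_, ?_, ?_⟩
  · refine Semidecidable.exists (p := fun (x : ℕ × (RatCode × RatCode)) (r : RatCode) =>
      (0 ≤ r.val ∧ r.val ≤ 1) ∧ x.2 = a (x.1, r)) (ComputablePred.semidecidable ?_)
    have hr : RatComputable fun y : (ℕ × (RatCode × RatCode)) × RatCode => y.2.val :=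
      Computable.snd.ratComputable
    refine ComputablePred.and ((RatComputable.le (by simpa using RatComputable.const_nat 0) hr).and
      (hr.le (by simpa using RatComputable.const_nat 1))) ?_
    exact (Primrec.eq (α := RatCode × RatCode)).computablePred.comp
      (f := fun y : (ℕ × (RatCode × RatCode)) × RatCode => (y.1.2, a (y.1.1, y.2)))
      ((Computable.snd.comp Computable.fst).pair
        (ha.comp ((Computable.fst.comp Computable.fst).pair Computable.snd)))
  · rintro n z ⟨r, hr, rfl⟩
    refine ⟨_, mem_image_of_mem f hr, (happrox n r hr).trans ?_⟩
    linarith [show (0 : ℝ) < (1 / 2) ^ n by positivity]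
  · rintro _ ⟨t, ht, rfl⟩ n
    obtain ⟨δ, hδ, h⟩ := Metric.continuousOn_iff.1 hf.continuousOn t ht ((1 / 2 : ℝ) ^ n)
      (by positivity)
    obtain ⟨r, hr, hrt⟩ := exists_ratCode_near ht hδ
    refine ⟨a (n, r), ⟨r, hr, rfl⟩, ?_⟩
    have h1 := h r.val hr (by rwa [Real.dist_eq])
    have h2 := happrox n r hr
    have h3 := dist_triangle_left (f t) (ratPoint (a (n, r))) (f r.val)
    linarith

theorem dist_le_of_mem_squareNhd {ε : ℝ} {w z : Plane} (h : w ∈ squareNhd ε z) :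
    dist w z ≤ 2 * ε := by
  have hε : 0 ≤ ε := (abs_nonneg _).trans h.1.le
  rw [EuclideanSpace.dist_eq]
  refine Real.sqrt_le_iff.2 ⟨by linarith, ?_⟩
  rw [Fin.sum_univ_two, Real.dist_eq, Real.dist_eq]
  nlinarith [h.1, h.2, abs_nonneg (w 0 - z 0), abs_nonneg (w 1 - z 1)]

theorem isBounded_coverUnion (Q : List RatTriple) : Bornology.IsBounded (coverUnion Q) := by
  have h : coverUnion Q = ⋃ v ∈ {v | v ∈ Q}, squareNhd v.radius v.center := rfl
  rw [h, Bornology.isBounded_biUnion Q.finite_toSet]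
  intro v _
  exact (Metric.isBounded_closedBall (x := v.center) (r := 2 * v.radius)).subset
    fun w hw => dist_le_of_mem_squareNhd hw

/-- Boundedness and nonemptiness make some `ε` admissible. Without that, `sInf` would take its
default value `0` and the bound would say nothing. -/
theorem exists_mem_squareNhd_of_planeHausdorffDist_lt {A B : Set Plane} {δ : ℝ}
    (hA : Bornology.IsBounded A) (hB : Bornology.IsBounded B) (hA0 : A.Nonempty)
    (hB0 : B.Nonempty) (h : planeHausdorffDist A B < δ) {z : Plane} (hz : z ∈ A) :
    ∃ w ∈ B, z ∈ squareNhd δ w := by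
  obtain ⟨R, hR⟩ := (hA.union hB).subset_closedBall 0
  have hfar : ∀ x ∈ A ∪ B, ∀ y ∈ A ∪ B, x ∈ squareNhd (2 * R + 1) y := by
    intro x hx y hy
    have hxR : ‖x‖ ≤ R := by simpa using hR hx
    have hyR : ‖y‖ ≤ R := by simpa using hR hy
    have hi : ∀ i, |x i - y i| < 2 * R + 1 := by
      intro i
      have h1 := PiLp.norm_apply_le (x - y) i
      rw [Real.norm_eq_abs, PiLp.sub_apply] at h1
      linarith [norm_sub_le x y]
    exact ⟨hi 0, hi 1⟩
  obtain ⟨p, hp⟩ := hA0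
  obtain ⟨q, hq⟩ := hB0
  have hR0 : 0 ≤ R := (norm_nonneg p).trans (by simpa using hR (Or.inl hp))
  have hne : {ε : ℝ | 0 < ε ∧ A ⊆ setNhd ε B ∧ B ⊆ setNhd ε A}.Nonempty :=
    ⟨2 * R + 1, by positivity, fun x hx => mem_biUnion hq (hfar x (Or.inl hx) q (Or.inr hq)),
      fun x hx => mem_biUnion hp (hfar x (Or.inr hx) p (Or.inl hp))⟩
  obtain ⟨ε, ⟨-, hAB, -⟩, hεδ⟩ := exists_lt_of_csInf_lt hne h
  obtain ⟨w, hw, hzw⟩ := mem_iUnion₂.1 (hAB hz)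
  exact ⟨w, hw, hzw.1.trans hεδ, hzw.2.trans hεδ⟩

/-- The rational points of the `n`-th cover are enumerated. The Hausdorff bound puts them near `S`,
and since the cover contains `S` and is open, they come near every point of `S`. -/
theorem IsKComputable.hasEnumerableApprox {S : Set Plane} (hS : IsKComputable S) :
    HasEnumerableApprox S := by
  obtain ⟨⟨g, hg⟩, Q, hQ, hcov⟩ := hS
  have hSb : Bornology.IsBounded S := by
    rw [← hg.2.2.2]
    exact (isCompact_Icc.image_of_continuousOn hg.2.1).isBounded
  have hS0 : S.Nonempty := ⟨g 0, hg.2.2.2 ▸ mem_image_of_mem g (by simp)⟩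
  refine ⟨fun n z => ∃ i : ℕ, ∃ v ∈ (Q n)[i]?,
    ((z.1.val - v.1.val < v.2.2.val ∧ v.1.val - z.1.val < v.2.2.val) ∧
      z.2.val - v.2.1.val < v.2.2.val ∧ v.2.1.val - z.2.val < v.2.2.val), ?_, ?_, ?_⟩
  · refine Semidecidable.exists_nat (p := fun (x : ℕ × (RatCode × RatCode)) i =>
      ∃ v ∈ (Q x.1)[i]?, ((x.2.1.val - v.1.val < v.2.2.val ∧ v.1.val - x.2.1.val < v.2.2.val) ∧
        x.2.2.val - v.2.1.val < v.2.2.val ∧ v.2.1.val - x.2.2.val < v.2.2.val)) ?_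
    refine Semidecidable.option (p := fun (x : (ℕ × (RatCode × RatCode)) × ℕ) (v : RatTriple) =>
      ((x.1.2.1.val - v.1.val < v.2.2.val ∧ v.1.val - x.1.2.1.val < v.2.2.val) ∧
        x.1.2.2.val - v.2.1.val < v.2.2.val ∧ v.2.1.val - x.1.2.2.val < v.2.2.val))
      (ComputablePred.semidecidable ?_)
      (Computable.list_getElem?.comp (hQ.comp (Computable.fst.comp Computable.fst)) Computable.snd)
    have hz : Computable fun y : ((ℕ × (RatCode × RatCode)) × ℕ) × RatTriple => y.1.1.2 :=
      Computable.snd.comp (Computable.fst.comp Computable.fst)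
    have hv : Computable fun y : ((ℕ × (RatCode × RatCode)) × ℕ) × RatTriple => y.2 :=
      Computable.snd
    have hz1 := (Computable.fst.comp hz).ratComputable
    have hz2 := (Computable.snd.comp hz).ratComputable
    have hv1 := (Computable.fst.comp hv).ratComputable
    have hv2 := (Computable.fst.comp (Computable.snd.comp hv)).ratComputable
    have hv3 := (Computable.snd.comp (Computable.snd.comp hv)).ratComputable
    exact (((hz1.sub hv1).lt hv3).and ((hv1.sub hz1).lt hv3)).and
      (((hz2.sub hv2).lt hv3).and ((hv2.sub hz2).lt hv3))
  · rintro n z ⟨i, v, hv, ⟨h1, h2⟩, h3, h4⟩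
    have hz : ratPoint z ∈ coverUnion (Q n) := by
      refine mem_biUnion (List.mem_of_getElem? hv) ⟨?_, ?_⟩
      · show |z.1.val - v.1.val| < v.2.2.val
        exact abs_lt.2 ⟨by linarith, h1⟩
      · show |z.2.val - v.2.1.val| < v.2.2.val
        exact abs_lt.2 ⟨by linarith, h3⟩
    obtain ⟨w, hw, hzw⟩ := exists_mem_squareNhd_of_planeHausdorffDist_lt (isBounded_coverUnion _)
      hSb ⟨_, hz⟩ hS0 (hcov n).2.2 hz
    refine ⟨w, hw, ?_⟩
    rw [dist_comm]
    exact dist_le_of_mem_squareNhd hzw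
  · intro w hw n
    obtain ⟨v, hv, hwv⟩ := mem_iUnion₂.1 ((hcov n).2.1 hw)
    obtain ⟨i, hi⟩ := List.mem_iff_getElem?.1 hv
    have hε : (0 : ℝ) < (1 / 2) ^ n := by positivity
    have hnear : ∀ x c : ℝ, |x - c| < v.2.2.val → ∃ q : RatCode,
        (q.val - c < v.2.2.val ∧ c - q.val < v.2.2.val) ∧ |x - q.val| < (1 / 2 : ℝ) ^ n := by
      intro x c hxc
      obtain ⟨h1, h2⟩ := abs_lt.1 hxc
      obtain ⟨q, h3, h4⟩ := RatCode.exists_between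
        (lt_min (by linarith) (by linarith) : x < min (c + v.2.2.val) (x + (1 / 2 : ℝ) ^ n))
      obtain ⟨h4, h5⟩ := lt_min_iff.1 h4
      exact ⟨q, ⟨by linarith, by linarith⟩, abs_lt.2 ⟨by linarith, by linarith⟩⟩
    obtain ⟨q₁, h1, h1'⟩ := hnear (w 0) v.1.val hwv.1
    obtain ⟨q₂, h2, h2'⟩ := hnear (w 1) v.2.1.val hwv.2
    exact ⟨(q₁, q₂), ⟨i, v, hi, h1, h2⟩, dist_le_of_mem_squareNhd ⟨h1', h2'⟩⟩

theorem hasEnumerableApprox_of_isComputable {S : Set Plane}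
    (hS : IsKComputable S ∨ IsRComputable S ∨ IsMComputable S ∨ IsNComputable S) :
    HasEnumerableApprox S := by
  rcases hS with h | ⟨-, f, hf, rfl⟩ | ⟨-, f, hf, -, rfl⟩ | ⟨-, -, f, hf, rfl, -⟩
  · exact h.hasEnumerableApprox
  all_goals exact hf.hasEnumerableApprox

/-! ### The length of a normalized curve with a segment of computable length -/

namespace IsConstSpeedParam

variable {f : ℝ → Plane} {l : ℝ} {C S : Set Plane}

/-- One searches for a rational chord whose approximate length exceeds `q` times the parameter
difference by the error `2 * 2 ^ (-n)` of its two ends. Squared distances keep the comparison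
rational. -/
theorem semidecidable_lt_speed (h : IsConstSpeedParam f l C) (hf : IsComputableFun f) :
    Semidecidable fun q : RatCode => 0 ≤ q.val ∧ q.val < l := by
  obtain ⟨a, ha, happrox⟩ := hf.exists_approx
  have hsemi : Semidecidable fun q : RatCode => 0 ≤ q.val ∧ ∃ x : ℕ × RatCode × RatCode,
      (0 ≤ x.2.1.val ∧ x.2.1.val < x.2.2.val ∧ x.2.2.val ≤ 1) ∧
      (q.val * (x.2.2.val - x.2.1.val) + 2 * (1 / 2 : ℝ) ^ x.1) ^ 2 <
        dist (ratPoint (a (x.1, x.2.1))) (ratPoint (a (x.1, x.2.2))) ^ 2 := by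
    have h0 {α : Type} [Primcodable α] : RatComputable fun _ : α => (0 : ℝ) := by
      simpa using RatComputable.const_nat 0
    have h1 {α : Type} [Primcodable α] : RatComputable fun _ : α => (1 : ℝ) := by
      simpa using RatComputable.const_nat 1
    have h2 {α : Type} [Primcodable α] : RatComputable fun _ : α => (2 : ℝ) := by
      simpa using RatComputable.const_nat 2
    refine Semidecidable.and (h0.le Computable.id.ratComputable).semidecidable
      (Semidecidable.exists (p := fun (q : RatCode) (x : ℕ × RatCode × RatCode) =>
        (0 ≤ x.2.1.val ∧ x.2.1.val < x.2.2.val ∧ x.2.2.val ≤ 1) ∧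
        (q.val * (x.2.2.val - x.2.1.val) + 2 * (1 / 2 : ℝ) ^ x.1) ^ 2 <
          dist (ratPoint (a (x.1, x.2.1))) (ratPoint (a (x.1, x.2.2))) ^ 2)
        (ComputablePred.semidecidable ?_))
    have hq : Computable fun y : RatCode × (ℕ × RatCode × RatCode) => y.1 := Computable.fst
    have hn : Computable fun y : RatCode × (ℕ × RatCode × RatCode) => y.2.1 :=
      Computable.fst.comp Computable.snd
    have hr : Computable fun y : RatCode × (ℕ × RatCode × RatCode) => y.2.2.1 :=
      Computable.fst.comp (Computable.snd.comp Computable.snd)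
    have hs : Computable fun y : RatCode × (ℕ × RatCode × RatCode) => y.2.2.2 :=
      Computable.snd.comp (Computable.snd.comp Computable.snd)
    exact ((h0.le hr.ratComputable).and ((hr.ratComputable.lt hs.ratComputable).and
      (hs.ratComputable.le h1))).and
      ((((hq.ratComputable.mul (hs.ratComputable.sub hr.ratComputable)).add
        (h2.mul (RatComputable.half_pow hn))).sq).lt
        (RatComputable.dist_sq (ha.comp (hn.pair hr)) (ha.comp (hn.pair hs))))
  refine hsemi.of_iff fun q => and_congr_right fun hq0 => ⟨?_, fun hq => ?_⟩
  · rintro ⟨⟨n, r, s⟩, ⟨hr, hrs, hs⟩, hlt⟩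
    dsimp only at hr hrs hs hlt
    have hr' : r.val ∈ Icc (0 : ℝ) 1 := ⟨hr, hrs.le.trans hs⟩
    have hs' : s.val ∈ Icc (0 : ℝ) 1 := ⟨hr.trans hrs.le, hs⟩
    have h1 := lt_of_pow_lt_pow_left₀ 2 dist_nonneg hlt
    have h2 := happrox n r hr'
    have h3 := happrox n s hs'
    have h4 := h.dist_le hr' hs'
    rw [abs_sub_comm, abs_of_pos (sub_pos.2 hrs)] at h4
    have h5 := dist_triangle4 (ratPoint (a (n, r))) (f r.val) (f s.val) (ratPoint (a (n, s)))
    rw [dist_comm _ (f r.val)] at h5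
    refine lt_of_mul_lt_mul_right (a := s.val - r.val) ?_ (sub_pos.2 hrs).le
    linarith
  · obtain ⟨x, hx, y, hy, hxy, hgap⟩ := h.exists_lt_dist hq0 hq
    set η := dist (f x) (f y) - q.val * (y - x) with hη
    have hη0 : 0 < η := sub_pos.2 hgap
    -- Moving each end to a rational costs at most `η / 4`. The other `η / 2` absorbs `4 * 2 ^
    -- (-n)`: the approximation error and the margin of the test. The bound `(y - x) / 2` keeps `r`
    -- before `s`.
    have hε : 0 < min (η / (4 * l)) ((y - x) / 2) :=
      lt_min (div_pos hη0 (by linarith [h.pos])) (by linarith)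
    obtain ⟨r, hr1, hr2⟩ := RatCode.exists_between (lt_add_of_pos_right x hε)
    obtain ⟨s, hs1, hs2⟩ := RatCode.exists_between (sub_lt_self y hε)
    have he1 := min_le_left (η / (4 * l)) ((y - x) / 2)
    have he2 := min_le_right (η / (4 * l)) ((y - x) / 2)
    have hrs : r.val < s.val := by linarith
    have hr' : r.val ∈ Icc (0 : ℝ) 1 := ⟨by linarith [hx.1], by linarith [hy.2]⟩
    have hs' : s.val ∈ Icc (0 : ℝ) 1 := ⟨by linarith [hx.1], by linarith [hy.2]⟩
    have hl : l * (η / (4 * l)) = η / 4 := by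
      have := h.pos.ne'
      field_simp
    have hdr : dist (f x) (f r.val) ≤ η / 4 := by
      refine (h.dist_le hx hr').trans (hl ▸ mul_le_mul_of_nonneg_left ?_ h.pos.le)
      rw [abs_le]
      constructor <;> linarith
    have hds : dist (f s.val) (f y) ≤ η / 4 := by
      refine (h.dist_le hs' hy).trans (hl ▸ mul_le_mul_of_nonneg_left ?_ h.pos.le)
      rw [abs_le]
      constructor <;> linarith
    obtain ⟨n, hn⟩ := exists_half_pow_lt (half_pos hη0) 4
    have h2 := happrox n r hr'
    have h3 := happrox n s hs'
    have h4 := dist_triangle4 (f x) (f r.val) (f s.val) (f y)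
    have h5 := dist_triangle4 (f r.val) (ratPoint (a (n, r))) (ratPoint (a (n, s))) (f s.val)
    rw [dist_comm (ratPoint (a (n, s))) (f s.val)] at h5
    have h6 : q.val * (s.val - r.val) ≤ q.val * (y - x) :=
      mul_le_mul_of_nonneg_left (by linarith) hq0
    refine ⟨(n, r, s), ⟨hr'.1, hrs, hs'.2⟩, pow_lt_pow_left₀ ?_ ?_ two_ne_zero⟩
    · dsimp only
      linarith
    · exact add_nonneg (mul_nonneg hq0 (sub_pos.2 hrs).le) (by positivity)

/-- A point of `S` off the compact set `f '' Icc u v` has positive distance from it. Since `f` is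
Lipschitz, a finite check on a dyadic grid confirms this at a fine enough scale. -/
theorem exists_semidecidable_not_subset (h : IsConstSpeedParam f l C) (hf : IsComputableFun f)
    (hS : HasEnumerableApprox S) :
    ∃ G : RatCode × RatCode → Prop, Semidecidable G ∧ ∀ u v : RatCode, 0 ≤ u.val →
      u.val ≤ v.val → v.val ≤ 1 → (G (u, v) ↔ ¬ S ⊆ f '' Icc u.val v.val) := by
  obtain ⟨a, ha, happrox⟩ := hf.exists_approx
  obtain ⟨A, hA, hsound, hcomplete⟩ := hS
  obtain ⟨M, hM⟩ := exists_nat_ge l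
  let grid : ℕ → ℕ → RatCode := fun n k => (k, 0, 2 ^ n - 1)
  have hgrid : ∀ n k, (grid n k).val = k * (1 / 2 : ℝ) ^ n := by
    intro n k
    simp only [grid, RatCode.val]
    rw [Nat.cast_sub Nat.one_le_two_pow]
    simp [div_eq_mul_inv]
  have hgrid_mem : ∀ n k, k < 2 ^ n + 1 → (grid n k).val ∈ Icc (0 : ℝ) 1 := by
    intro n k hk
    rw [hgrid]
    refine ⟨by positivity, ?_⟩
    have h1 : (k : ℝ) ≤ 2 ^ n := by exact_mod_cast Nat.lt_succ_iff.1 hk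
    rw [one_div, inv_pow]
    exact mul_inv_le_one_of_le₀ h1 (by positivity)
  have hlip : ∀ x ∈ Icc (0 : ℝ) 1, ∀ y ∈ Icc (0 : ℝ) 1, ∀ n : ℕ, |x - y| ≤ (1 / 2 : ℝ) ^ n →
      dist (f x) (f y) ≤ M * (1 / 2 : ℝ) ^ n := fun x hx y hy n hxy =>
    (h.dist_le hx hy).trans (mul_le_mul hM hxy (abs_nonneg _) (Nat.cast_nonneg M))
  -- Grid points more than one mesh outside the interval are exempt. If `S` is contained, some grid
  -- value is within `M + 3` units of `2 ^ (-n)` from `z`: `M` for the mesh, one for the value, two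
  -- for `z`. So `M + 4` is sound.
  let P : RatCode × RatCode → ℕ → RatCode × RatCode → ℕ → Prop := fun x n z k =>
    ((k : ℝ) * (1 / 2 : ℝ) ^ n < x.1.val - (1 / 2 : ℝ) ^ n ∨
      x.2.val + (1 / 2 : ℝ) ^ n < k * (1 / 2 : ℝ) ^ n) ∨
      ((M + 4 : ℕ) * (1 / 2 : ℝ) ^ n) ^ 2 < dist (ratPoint (a (n, grid n k))) (ratPoint z) ^ 2
  refine ⟨fun x => ∃ y : ℕ × (RatCode × RatCode), A y.1 y.2 ∧
    ∀ k < 2 ^ y.1 + 1, P x y.1 y.2 k, ?_, fun u v hu huv hv => ⟨?_, fun hsub => ?_⟩⟩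
  · refine Semidecidable.exists (p := fun x (y : ℕ × (RatCode × RatCode)) => A y.1 y.2 ∧
      ∀ k < 2 ^ y.1 + 1, P x y.1 y.2 k)
      ((hA.comp Computable.snd).and (ComputablePred.semidecidable ?_))
    refine ComputablePred.forall_lt (p := fun (x : (RatCode × RatCode) × (ℕ × (RatCode × RatCode)))
      k => P x.1 x.2.1 x.2.2 k) ?_
      ((Computable.two_pow (Computable.fst.comp Computable.snd)).natAdd (Computable.const 1))
    have hu : Computable fun x : ((RatCode × RatCode) × (ℕ × (RatCode × RatCode))) × ℕ =>
      x.1.1.1 := Computable.fst.comp (Computable.fst.comp Computable.fst)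
    have hv : Computable fun x : ((RatCode × RatCode) × (ℕ × (RatCode × RatCode))) × ℕ =>
      x.1.1.2 := Computable.snd.comp (Computable.fst.comp Computable.fst)
    have hn : Computable fun x : ((RatCode × RatCode) × (ℕ × (RatCode × RatCode))) × ℕ =>
      x.1.2.1 := Computable.fst.comp (Computable.snd.comp Computable.fst)
    have hz : Computable fun x : ((RatCode × RatCode) × (ℕ × (RatCode × RatCode))) × ℕ =>
      x.1.2.2 := Computable.snd.comp (Computable.snd.comp Computable.fst)
    have hk : Computable fun x : ((RatCode × RatCode) × (ℕ × (RatCode × RatCode))) × ℕ =>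
      x.2 := Computable.snd
    have hε := RatComputable.half_pow hn
    have hg := (RatComputable.natCast hk).mul hε
    have hgc : Computable fun x : ((RatCode × RatCode) × (ℕ × (RatCode × RatCode))) × ℕ =>
        grid x.1.2.1 x.2 :=
      hk.pair ((Computable.const 0).pair (hn.two_pow.natSub (Computable.const 1)))
    exact ((hg.lt (hu.ratComputable.sub hε)).or ((hv.ratComputable.add hε).lt hg)).or
      ((((RatComputable.const_nat (M + 4)).mul hε).sq).lt
        (RatComputable.dist_sq (ha.comp (hn.pair hgc)) hz))
  · rintro ⟨⟨n, z⟩, hAz, hP⟩ hsub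
    obtain ⟨w, hw, hwz⟩ := hsound n z hAz
    obtain ⟨x, hx, rfl⟩ := hsub hw
    dsimp only at hP
    have hε : (0 : ℝ) < (1 / 2) ^ n := by positivity
    have hpow : (2 : ℝ) ^ n * (1 / 2 : ℝ) ^ n = 1 := by rw [← mul_pow]; norm_num
    have hx' : x ∈ Icc (0 : ℝ) 1 := ⟨hu.trans hx.1, hx.2.trans hv⟩
    set k := ⌊x * 2 ^ n⌋₊
    have hk1 : (k : ℝ) ≤ x * 2 ^ n := Nat.floor_le (mul_nonneg hx'.1 (by positivity))
    have hk2 : x * 2 ^ n < k + 1 := Nat.lt_floor_add_one _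
    have hk : k < 2 ^ n + 1 := by
      have h1 : (k : ℝ) ≤ 2 ^ n := hk1.trans (mul_le_of_le_one_left (by positivity) hx'.2)
      exact Nat.lt_succ_iff.2 (by exact_mod_cast h1)
    have hg1 : k * (1 / 2 : ℝ) ^ n ≤ x := by
      have := mul_le_mul_of_nonneg_right hk1 hε.le
      rwa [mul_assoc, hpow, mul_one] at this
    have hg2 : x - (1 / 2 : ℝ) ^ n ≤ k * (1 / 2 : ℝ) ^ n := by
      have := mul_le_mul_of_nonneg_right hk2.le hε.le
      rw [mul_assoc, hpow, mul_one, add_mul, one_mul] at this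
      linarith
    rcases hP k hk with (h1 | h1) | h1
    · have h1' : (k : ℝ) * (1 / 2 : ℝ) ^ n < u.val - (1 / 2 : ℝ) ^ n := h1
      linarith [hx.1]
    · have h1' : v.val + (1 / 2 : ℝ) ^ n < k * (1 / 2 : ℝ) ^ n := h1
      linarith [hx.2]
    · have h2 := lt_of_pow_lt_pow_left₀ 2 dist_nonneg h1
      have h3 := happrox n _ (hgrid_mem n k hk)
      have h4 := hlip _ (hgrid_mem n k hk) x hx' n (by
        rw [hgrid, abs_le]
        constructor <;> linarith)
      have h5 := dist_triangle4 (ratPoint (a (n, grid n k))) (f (grid n k).val) (f x) (ratPoint z)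
      rw [dist_comm _ (f (grid n k).val)] at h5
      push_cast at h2
      linarith
  · obtain ⟨w, hw, hwf⟩ := not_subset.1 hsub
    have hsub' : Icc u.val v.val ⊆ Icc (0 : ℝ) 1 := Icc_subset_Icc hu hv
    have hclosed : IsClosed (f '' Icc u.val v.val) :=
      (isCompact_Icc.image_of_continuousOn (h.isInjParam.2.1.mono hsub')).isClosed
    obtain ⟨δ, hδ, hball⟩ := Metric.isOpen_iff.1 hclosed.isOpen_compl w hwf
    -- A failed test would put `w` within `M + 1 + (M + 4) + 2` units of `f '' Icc u v`.
    obtain ⟨n, hn⟩ := exists_half_pow_lt hδ (2 * M + 7)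
    have hε : (0 : ℝ) < (1 / 2) ^ n := by positivity
    obtain ⟨z, hAz, hwz⟩ := hcomplete w hw n
    refine ⟨(n, z), hAz, fun k hk => ?_⟩
    by_contra! hcon
    simp only [P, not_or, not_lt] at hcon
    obtain ⟨⟨h1, h2⟩, h3⟩ := hcon
    rw [← hgrid] at h1 h2
    set g := (grid n k).val
    -- The grid point is clamped to `[u, v]`, moving by at most one mesh.
    set x := max u.val (min g v.val)
    have hx : x ∈ Icc u.val v.val := ⟨le_max_left _ _, max_le huv (min_le_right _ _)⟩
    have hgx : |x - g| ≤ (1 / 2 : ℝ) ^ n := by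
      rw [abs_le]
      constructor
      · have : min g v.val ≤ x := le_max_right _ _
        have : g - (1 / 2 : ℝ) ^ n ≤ min g v.val := le_min (by linarith) (by linarith)
        linarith
      · have : x ≤ g + (1 / 2 : ℝ) ^ n := max_le (by linarith) ((min_le_left _ _).trans (by linarith))
        linarith
    have h4 := hlip x (hsub' hx) g (hgrid_mem n k hk) n hgx
    have h5 := happrox n _ (hgrid_mem n k hk)
    have h6 : dist (ratPoint (a (n, grid n k))) (ratPoint z) ≤ (M + 4 : ℕ) * (1 / 2 : ℝ) ^ n :=
      le_of_sq_le_sq h3 (by positivity)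
    have h7 : δ ≤ dist (f x) w := by
      by_contra! hlt
      exact hball (Metric.mem_ball.2 hlt) (mem_image_of_mem f hx)
    have h8 := dist_triangle4 (f x) (f g) (ratPoint (a (n, grid n k))) w
    have h9 := dist_triangle_right (ratPoint (a (n, grid n k))) w (ratPoint z)
    push_cast at h6
    linarith

/-- For the upper cut, `l < q` holds exactly when `l * (t - s) < q * (v - u)` for some rationals `u
< v` with `s < u` and `v < t`. Each of these conditions is semidecidable. -/
theorem isComputableReal_of_segment (h : IsConstSpeedParam f l C) (hf : IsComputableFun f)
    (hS : HasEnumerableApprox S) {s t : ℝ} (hs : 0 ≤ s) (hst : s < t) (ht : t ≤ 1)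
    (hSeq : S = f '' Icc s t) (hlen : IsComputableReal (l * (t - s))) : IsComputableReal l := by
  obtain ⟨G, hG, hGspec⟩ := h.exists_semidecidable_not_subset hf hS
  have hinj := h.isInjParam.2.2.1
  let zero : RatCode := (0, 0, 0)
  let one : RatCode := (1, 0, 0)
  have hzero : zero.val = 0 := by simp [zero, RatCode.val]
  have hone : one.val = 1 := by simp [one, RatCode.val]
  have hleft : ∀ u : RatCode, 0 ≤ u.val → u.val ≤ 1 → (G (u, one) ↔ s < u.val) := by
    intro u h0 h1
    rw [hGspec u one h0 (hone ▸ h1) hone.le, hone, ← not_le, not_iff_not, hSeq]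
    refine ⟨fun hsub => ?_, fun hle => image_mono (Icc_subset_Icc hle ht)⟩
    obtain ⟨x, hx, hxs⟩ := hsub (mem_image_of_mem f (left_mem_Icc.2 hst.le))
    rw [← hinj ⟨h0.trans hx.1, hx.2⟩ ⟨hs, hst.le.trans ht⟩ hxs]
    exact hx.1
  have hright : ∀ v : RatCode, 0 ≤ v.val → v.val ≤ 1 → (G (zero, v) ↔ v.val < t) := by
    intro v h0 h1
    rw [hGspec zero v hzero.ge (hzero ▸ h0) h1, hzero, ← not_le, not_iff_not, hSeq]
    refine ⟨fun hsub => ?_, fun hle => image_mono (Icc_subset_Icc hs hle)⟩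
    obtain ⟨x, hx, hxt⟩ := hsub (mem_image_of_mem f (right_mem_Icc.2 hst.le))
    rw [← hinj ⟨hx.1, hx.2.trans h1⟩ ⟨hs.trans hst.le, ht⟩ hxt]
    exact hx.2
  refine isComputableReal_of_semidecidable h.pos (h.semidecidable_lt_speed hf) ?_
  have hsemi : Semidecidable fun q : RatCode => ∃ x : RatCode × RatCode,
      (0 ≤ x.1.val ∧ x.1.val < x.2.val ∧ x.2.val ≤ 1) ∧ (G (x.1, one) ∧ G (zero, x.2)) ∧
        l * (t - s) < q.val * (x.2.val - x.1.val) := by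
    have hq : RatComputable fun y : RatCode × (RatCode × RatCode) => y.1.val :=
      Computable.fst.ratComputable
    have hu : Computable fun y : RatCode × (RatCode × RatCode) => y.2.1 :=
      Computable.fst.comp Computable.snd
    have hv : Computable fun y : RatCode × (RatCode × RatCode) => y.2.2 :=
      Computable.snd.comp Computable.snd
    refine Semidecidable.exists (p := fun (q : RatCode) (x : RatCode × RatCode) =>
      (0 ≤ x.1.val ∧ x.1.val < x.2.val ∧ x.2.val ≤ 1) ∧ (G (x.1, one) ∧ G (zero, x.2)) ∧
        l * (t - s) < q.val * (x.2.val - x.1.val)) (Semidecidable.and ?_ (Semidecidable.and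
          ((hG.comp (hu.pair (Computable.const one))).and
            (hG.comp ((Computable.const zero).pair hv)))
          (hlen.semidecidable_lt (hq.mul (hv.ratComputable.sub hu.ratComputable)))))
    exact ((RatComputable.le (by simpa using RatComputable.const_nat 0) hu.ratComputable).and
      ((hu.ratComputable.lt hv.ratComputable).and (hv.ratComputable.le
        (by simpa using RatComputable.const_nat 1)))).semidecidable
  refine hsemi.of_iff fun q => ⟨?_, fun hq => ?_⟩
  · rintro ⟨⟨u, v⟩, ⟨hu, huv, hv⟩, ⟨hGu, hGv⟩, hlt⟩
    dsimp only at hu huv hv hGu hGv hlt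
    rw [hleft u hu (huv.le.trans hv)] at hGu
    rw [hright v (hu.trans huv.le) hv] at hGv
    refine lt_of_mul_lt_mul_right (a := v.val - u.val) (lt_of_le_of_lt ?_ hlt) (sub_pos.2 huv).le
    exact mul_le_mul_of_nonneg_left (by linarith) h.pos.le
  · have hq0 : 0 < q.val := h.pos.trans hq
    have hD : l * (t - s) / q.val < t - s := by
      rw [div_lt_iff₀ hq0, mul_comm]
      exact mul_lt_mul_of_pos_left hq (sub_pos.2 hst)
    have hD0 : 0 < l * (t - s) / q.val := div_pos (mul_pos h.pos (sub_pos.2 hst)) hq0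
    set D := l * (t - s) / q.val with hDdef
    -- Shrinking each end by less than this keeps `v - u` above `D`, the least width that works for
    -- `q`.
    have hε : 0 < (t - s - D) / 2 := by linarith
    obtain ⟨u, hu1, hu2⟩ := RatCode.exists_between (lt_add_of_pos_right s hε)
    obtain ⟨v, hv1, hv2⟩ := RatCode.exists_between (sub_lt_self t hε)
    have hu0 : 0 ≤ u.val := by linarith
    have hv0 : v.val ≤ 1 := by linarith
    have huv : u.val < v.val := by linarith
    refine ⟨(u, v), ⟨hu0, huv, hv0⟩, ⟨(hleft u hu0 (by linarith)).2 hu1,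
      (hright v (by linarith) hv0).2 hv2⟩, ?_⟩
    dsimp only
    rw [mul_comm q.val, ← div_lt_iff₀ hq0]
    linarith

end IsConstSpeedParam

theorem lemma4p1 (C : Set Plane) (hC : IsNComputable C) :
    (¬ HasComputableLength C →
      ∀ S : Set Plane, IsNontrivialSegment S C → S ∉ curvesOfComputableLength) ∧
    (C ∈ curvesOfComputableLength ∨
      ∀ S : Set Plane, IsNontrivialSegment S C → S ∉ curvesOfComputableLength) := by
  have main : ¬ HasComputableLength C →
      ∀ S : Set Plane, IsNontrivialSegment S C → S ∉ curvesOfComputableLength := by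
    rintro hlen S hS ⟨hScomp, hSlen⟩
    obtain ⟨hsimple, hrect, f, hf, hfC, hfl⟩ := id hC
    have h := isConstSpeedParam_of_arcLength hsimple hrect hf.continuousOn hfC hfl
    obtain ⟨s, t, hs, hst, ht, hSeq⟩ := h.exists_segment_eq hS
    have hl := hSlen.2
    rw [hSeq, h.arcLength_image hs hst.le ht,
      ENNReal.toReal_ofReal (mul_nonneg h.pos.le (sub_pos.2 hst).le)] at hl
    exact hlen ⟨hrect, h.isComputableReal_of_segment hf
      (hasEnumerableApprox_of_isComputable hScomp) hs hst ht hSeq hl⟩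
  refine ⟨main, ?_⟩
  by_cases hlen : HasComputableLength C
  · exact Or.inl ⟨Or.inr (Or.inr (Or.inr hC)), hlen⟩
  · exact Or.inr (main hlen)
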